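/- Let $\Omega$ be a smooth ($C^\infty$, Hausdorff, second countable, without boundary) $n$-dimensional manifold, let $E$ be a smooth real vector bundle of finite rank on $\Omega$, and let $\nabla$, $\nabla_E$ be smooth linear connections on $T^*_\Omega$ and $E$. Define differential operators $D^k$ from local sections of $E$ to local sections of $T_\Omega^{*\otimes k}\otimes E$ by $D^0=\mathrm{id}$ and $D^{k+1}=(\nabla^{\otimes k}\otimes\nabla_E)\circ D^k$, where $\nabla^{\otimes k}\otimes\nabla_E$ is the tensor product connection (so $D^1=\nabla_E$). Let $X\subset\Omega$ be an open subset whose closure $\bar X$ is a smooth submanifold with boundary $\partial\bar X=\bar X\setminus X$, and let $s$ be a section of $E$ on $\bar X$ which is smooth (up to the boundary). Then for every $k\ge 0$ the section $D^k(s|_X)$ extends continuously to $\bar X$; denote the extension by $D^ks$. Let $O\subset\Omega$ be an open set containing $X$, and let $\sigma$ be a smooth section of $E$ on $O$ such that $\sigma|_X=s|_X$. Then there exists an open subset $O'\subset O$ such that $\bar X\cap O'=\bar X\cap O$ and, for every $k\ge 0$, the following holds: for every sequence $(u_m)_m$ of points of $O'$ which converges to a point $x\in\bar X\setminus O'$ (equivalently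 $x\in \bar X\setminus O$), the sequence $(D^k\sigma)(u_m)$ converges, in the total space of $T_\Omega^{*\otimes k}\otimes E$, to $(D^ks)(x)$. Moreover, $O'$ can be chosen such that in addition the following holds. Let $Y\subset O'$ be any open subset whose closure $\bar Y$ is a smooth submanifold with boundary $\partial \bar Y=\bar Y\setminus Y$ and such that $X\subset\bar X\cap O'\subset Y\subset\bar Y\subset\bar X\cup O'$. Then the section of $E$ on $\bar X\cup O'$ which equals $s$ on $\bar X$ and $\sigma$ on $O'$ is well defined, and its restriction to $\bar Y$ is smooth (up to the boundary). -/

import Mathlib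

open Bundle Set Filter Topology
open scoped Manifold ContDiff

noncomputable section

universe u v w

/-- A real topological vector bundle over `M` with normed model fibre, bundled so that the tensor
bundles `T*M ⊗ ⋯ ⊗ T*M ⊗ E` can be defined by recursion. -/
structure RealBundle (M : Type w) [TopologicalSpace M] where
  /-- The model fibre. -/
  F : Type u
  /-- The fibres. -/
  V : M → Type v
  [normedAddCommGroup : NormedAddCommGroup F]
  [normedSpace : NormedSpace ℝ F]
  [topTotal : TopologicalSpace (TotalSpace F V)]
  [addCommGroup : ∀ x, AddCommGroup (V x)]
  [module : ∀ x, Module ℝ (V x)]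
  [top : ∀ x, TopologicalSpace (V x)]
  [topAddGroup : ∀ x, IsTopologicalAddGroup (V x)]
  [continuousSMul : ∀ x, ContinuousSMul ℝ (V x)]
  [fiberBundle : FiberBundle F V]
  [vectorBundle : VectorBundle ℝ F V]

attribute [instance] RealBundle.normedAddCommGroup RealBundle.normedSpace RealBundle.topTotal
  RealBundle.addCommGroup RealBundle.module RealBundle.top RealBundle.topAddGroup
  RealBundle.continuousSMul RealBundle.fiberBundle RealBundle.vectorBundle

namespace RealBundle

variable {n : ℕ} {M : Type w} [TopologicalSpace M] [ChartedSpace (EuclideanSpace ℝ (Fin n)) M]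
  [IsManifold (𝓡 n) ∞ M]

/-- The bundle `T*M ⊗ W`, realized as `Hom(TM, W)`. -/
def cotangentTensor (n : ℕ) {M : Type w} [TopologicalSpace M]
    [ChartedSpace (EuclideanSpace ℝ (Fin n)) M] [IsManifold (𝓡 n) ∞ M]
    (W : RealBundle.{u, v, w} M) : RealBundle.{u, v, w} M where
  F := EuclideanSpace ℝ (Fin n) →L[ℝ] W.F
  V := fun x => TangentSpace (𝓡 n) x →L[ℝ] W.V x

/-- The bundle `(T*M)^{⊗ k} ⊗ W`. -/
def tensorPower (n : ℕ) {M : Type w} [TopologicalSpace M]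
    [ChartedSpace (EuclideanSpace ℝ (Fin n)) M] [IsManifold (𝓡 n) ∞ M]
    (W : RealBundle.{u, v, w} M) : ℕ → RealBundle.{u, v, w} M
  | 0 => W
  | k + 1 => cotangentTensor n (tensorPower n W k)

/-- The `i`-th vector field of the local frame of `TM` over the base set of the preferred
trivialization at `x₀`. -/
def frame (x₀ : M) (i : Fin n) (x : M) : TangentSpace (𝓡 n) x :=
  (trivializationAt (EuclideanSpace ℝ (Fin n)) (TangentSpace (𝓡 n) : M → Type) x₀).symmL ℝ x
    (EuclideanSpace.single i 1)

/-- The `i`-th one-form of the local coframe dual to `frame x₀`. -/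
def coframe (x₀ : M) (i : Fin n) (x : M) : TangentSpace (𝓡 n) x →L[ℝ] Trivial M ℝ x :=
  (EuclideanSpace.proj i : EuclideanSpace ℝ (Fin n) →L[ℝ] ℝ).comp
    ((trivializationAt (EuclideanSpace ℝ (Fin n))
      (TangentSpace (𝓡 n) : M → Type) x₀).continuousLinearMapAt ℝ x)

/-- The elementary tensor `α ⊗ w ∈ T*ₓM ⊗ Wₓ`. -/
def tmul {W : RealBundle.{u, v, w} M} {x : M} (α : TangentSpace (𝓡 n) x →L[ℝ] Trivial M ℝ x)
    (w : W.V x) : TangentSpace (𝓡 n) x →L[ℝ] W.V x :=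
  ContinuousLinearMap.smulRight (M₁ := TangentSpace (𝓡 n) x) (S := ℝ) α w

/-- The tensor product connection `∇ ⊗ ∇'` on `T*M ⊗ W`: a section `φ` is written in a local
coframe as `∑ᵢ αᵢ ⊗ φ(eᵢ)`, and each summand is differentiated by the Leibniz rule,
`∇_ξ (α ⊗ w) = ∇_ξ α ⊗ w + α ⊗ ∇'_ξ w`. -/
def tensorConnection {W : RealBundle.{u, v, w} M}
    (nabla : (Π x : M, TangentSpace (𝓡 n) x →L[ℝ] Trivial M ℝ x) →
      Π x : M, TangentSpace (𝓡 n) x →L[ℝ] (TangentSpace (𝓡 n) x →L[ℝ] Trivial M ℝ x))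
    (nabla' : (Π x : M, W.V x) → Π x : M, TangentSpace (𝓡 n) x →L[ℝ] W.V x)
    (φ : Π x : M, TangentSpace (𝓡 n) x →L[ℝ] W.V x) (x : M) :
    TangentSpace (𝓡 n) x →L[ℝ] (TangentSpace (𝓡 n) x →L[ℝ] W.V x) :=
  haveI : FiniteDimensional ℝ (TangentSpace (𝓡 n) x) :=
    inferInstanceAs (FiniteDimensional ℝ (EuclideanSpace ℝ (Fin n)))
  haveI : T2Space (TangentSpace (𝓡 n) x) :=
    inferInstanceAs (T2Space (EuclideanSpace ℝ (Fin n)))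
  LinearMap.toContinuousLinearMap
    { toFun := fun ξ => ∑ i : Fin n,
        ((tmul (nabla (coframe x i) x ξ) (φ x (frame x i x)) :
            TangentSpace (𝓡 n) x →L[ℝ] W.V x) +
          tmul (coframe x i x) (nabla' (fun y => φ y (frame x i y)) x ξ))
      map_add' := by
        intro ξ η
        rw [← Finset.sum_add_distrib]
        refine Finset.sum_congr rfl fun i _ => ?_
        ext ζ
        simp only [tmul, map_add, add_apply,
          ContinuousLinearMap.smulRight_apply, smul_add, add_smul]
        abel
      map_smul' := by
        intro c ξ
        rw [RingHom.id_apply, Finset.smul_sum]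
        refine Finset.sum_congr rfl fun i _ => ?_
        ext ζ
        simp only [tmul, map_smul, add_apply, smul_apply,
          ContinuousLinearMap.smulRight_apply, smul_add, smul_assoc]
        rw [smul_comm c, smul_comm c] }

/-- The connection `∇^{⊗ k} ⊗ ∇_E` on `(T*M)^{⊗ k} ⊗ W`. -/
def tensorPowerConnection {W : RealBundle.{u, v, w} M}
    (nabla : (Π x : M, TangentSpace (𝓡 n) x →L[ℝ] Trivial M ℝ x) →
      Π x : M, TangentSpace (𝓡 n) x →L[ℝ] (TangentSpace (𝓡 n) x →L[ℝ] Trivial M ℝ x))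
    (nablaW : (Π x : M, W.V x) → Π x : M, TangentSpace (𝓡 n) x →L[ℝ] W.V x) :
    (k : ℕ) → (Π x : M, (tensorPower n W k).V x) →
      Π x : M, TangentSpace (𝓡 n) x →L[ℝ] (tensorPower n W k).V x
  | 0 => nablaW
  | k + 1 => tensorConnection (W := tensorPower n W k) nabla
      (tensorPowerConnection nabla nablaW k)

/-- The iterated covariant derivative: `D⁰ = id` and `Dᵏ⁺¹ = (∇^{⊗ k} ⊗ ∇_E) ∘ Dᵏ`; in particular
`D¹ = ∇_E`. -/
def iteratedCov {W : RealBundle.{u, v, w} M}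
    (nabla : (Π x : M, TangentSpace (𝓡 n) x →L[ℝ] Trivial M ℝ x) →
      Π x : M, TangentSpace (𝓡 n) x →L[ℝ] (TangentSpace (𝓡 n) x →L[ℝ] Trivial M ℝ x))
    (nablaW : (Π x : M, W.V x) → Π x : M, TangentSpace (𝓡 n) x →L[ℝ] W.V x)
    (s : Π x : M, W.V x) : (k : ℕ) → Π x : M, (tensorPower n W k).V x
  | 0 => s
  | k + 1 => tensorPowerConnection nabla nablaW k (iteratedCov nabla nablaW s k)

end RealBundle

section Sections

variable {n : ℕ} {M : Type w} [TopologicalSpace M] [ChartedSpace (EuclideanSpace ℝ (Fin n)) M]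
  [IsManifold (𝓡 n) ∞ M]
  {F : Type u} [NormedAddCommGroup F] [NormedSpace ℝ F]
  {E : M → Type v} [TopologicalSpace (TotalSpace F E)]
  [∀ x, AddCommGroup (E x)] [∀ x, Module ℝ (E x)] [∀ x, TopologicalSpace (E x)]
  [∀ x, IsTopologicalAddGroup (E x)] [∀ x, ContinuousSMul ℝ (E x)]
  [FiberBundle F E] [VectorBundle ℝ F E]

/-- A linear connection on the cotangent bundle of the `n`-manifold `M`. -/
abbrev CotangentConnection (n : ℕ) (M : Type w) [TopologicalSpace M]
    [ChartedSpace (EuclideanSpace ℝ (Fin n)) M] [IsManifold (𝓡 n) ∞ M] :=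
  CovariantDerivative (𝓡 n) (EuclideanSpace ℝ (Fin n) →L[ℝ] ℝ)
    (fun x : M => TangentSpace (𝓡 n) x →L[ℝ] Trivial M ℝ x)

variable (F E) in
/-- The total space of `(T*M)^{⊗ k} ⊗ E`, with its bundle topology. -/
abbrev CovTensor (n : ℕ) [ChartedSpace (EuclideanSpace ℝ (Fin n)) M] [IsManifold (𝓡 n) ∞ M]
    (k : ℕ) : Type _ :=
  TotalSpace (RealBundle.tensorPower n (RealBundle.mk F E) k).F
    (RealBundle.tensorPower n (RealBundle.mk F E) k).V

/-- `Dᵏ s` as a map from `M` to the total space of `(T*M)^{⊗ k} ⊗ E`. The value at `x` is meaningful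
where `s` is smooth near `x`, and then depends on the germ of `s` at `x` only. -/
def covDeriv (nabla : CotangentConnection n M) (nablaE : CovariantDerivative (𝓡 n) F E)
    (k : ℕ) (s : Π x : M, E x) (x : M) : CovTensor F E n k :=
  ⟨x, RealBundle.iteratedCov (W := RealBundle.mk F E) nabla.toFun nablaE.toFun s k x⟩

/-- `Dᵏ s` on the closure of the open set `X`, for a section `s` over the closure: the continuous
extension of the restriction of `Dᵏ s` to `X`. -/
def covDerivClosure (nabla : CotangentConnection n M) (nablaE : CovariantDerivative (𝓡 n) F E)
    (X : Set M) (k : ℕ) (s : Π x : M, E x) : M → CovTensor F E n k :=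
  extendFrom X (covDeriv nabla nablaE k s)

/-- The section `s` of `E` is defined and smooth on `A` (its values off `A` are irrelevant). For `A`
the closure of a domain with smooth boundary this means smooth up to the boundary. -/
def SmoothSectionOn (F : Type u) [NormedAddCommGroup F] [NormedSpace ℝ F]
    [TopologicalSpace (TotalSpace F E)] [FiberBundle F E]
    (n : ℕ) [ChartedSpace (EuclideanSpace ℝ (Fin n)) M]
    (s : Π x : M, E x) (A : Set M) : Prop :=
  ContMDiffOn (𝓡 n) ((𝓡 n).prod 𝓘(ℝ, F)) ∞ (fun x => (⟨x, s x⟩ : TotalSpace F E)) A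

/-- `X` is open and its closure is a smooth submanifold with boundary `closure X \ X`: near each
point of `closure X \ X` there is a chart of the smooth structure in which `closure X` is a closed
half-space and `X` is its interior. -/
def HasSmoothBoundary (n : ℕ) {M : Type w} [TopologicalSpace M]
    [ChartedSpace (EuclideanSpace ℝ (Fin n)) M] (X : Set M) : Prop :=
  IsOpen X ∧ ∀ p ∈ closure X \ X,
    ∃ φ ∈ IsManifold.maximalAtlas (𝓡 n) ∞ M, p ∈ φ.source ∧
      ∃ l : EuclideanSpace ℝ (Fin n) →L[ℝ] ℝ, l ≠ 0 ∧ ∀ x ∈ φ.source,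
        (x ∈ closure X ↔ 0 ≤ l (φ x)) ∧ (x ∈ X ↔ 0 < l (φ x))

/-- Property `P_k` of the triple `(s, O, σ)`: for every sequence of `O` converging to a point `x` of
`closure X \ O`, the sequence of values of `Dᵏ σ` converges to `(Dᵏ s)(x)`. -/
def PropertyP (nabla : CotangentConnection n M) (nablaE : CovariantDerivative (𝓡 n) F E)
    (X : Set M) (k : ℕ) (s : Π x : M, E x) (O : Set M) (σ : Π x : M, E x) : Prop :=
  ∀ (a : ℕ → M) (x : M), (∀ m, a m ∈ O) → x ∈ closure X \ O → Tendsto a atTop (𝓝 x) →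
    Tendsto (fun m => covDeriv nabla nablaE k σ (a m)) atTop
      (𝓝 (covDerivClosure nabla nablaE X k s x))

/-- `closure Y` is a submanifold with boundary which interpolates between `closure X` and `O`. -/
def Interpolates (n : ℕ) {M : Type w} [TopologicalSpace M]
    [ChartedSpace (EuclideanSpace ℝ (Fin n)) M] (X O Y : Set M) : Prop :=
  HasSmoothBoundary n Y ∧ X ⊆ closure X ∩ O ∧ closure X ∩ O ⊆ Y ∧ Y ⊆ O ∧
    closure Y ⊆ closure X ∪ O

end Sections

end

/-! In a chart and a trivialization a smooth connection has the form d + Γ with smooth Γ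
(`CovariantDerivative.exists_hasChristoffel`), and this form is inherited by tensor products
(`HasChristoffel.tensorConnection`). So in coordinates Dᵏ⁺¹ = (d + Γₖ) Dᵏ, and D⁰, …, Dᵏ carry the
same information as the partial derivatives of order at most k. In particular Dᵏ s extends
continuously from X to its closure, and by density of X the extension coincides with Dᵏ σ on
`closure X ∩ O`.

The total spaces of the tensor bundles are metrizable, so values of Dᵏ σ in different fibres can be
compared. Around each p in `closure X ∩ O` take a small open set on which Dᵏ σ differs from its
value at p by less than ε(p), for all k < 1/ε(p), where ε(p) is half the distance from p to `closure
X \ O`; O' is the union of these sets (`exists_isOpen_tendsto`). A sequence in O' tending to x in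
`closure X \ O` is shadowed by a sequence in `closure X ∩ O` tending to x. Along the latter Dᵏ σ =
Dᵏ s tends to (Dᵏ s)(x), and for fixed k the error tends to zero.

Consequently Dᵏ s and Dᵏ σ glue to a continuous section over `closure X ∪ O'`, for every k. On
`closure Y` the smooth section σ|Y therefore has all its covariant derivatives continuous up to the
boundary. The mean value inequality in a half-space turns continuous extensions of derivatives into
derivatives at the boundary (`IsHalfSpaceParam.hasFDerivWithinAt`), and induction on the order of
differentiability gives smoothness (`contDiffOn_of_continuousOn_repCov`). -/

noncomputable section

universe u v w

set_option maxSynthPendingDepth 3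

/-! ### Sections and connections in local coordinates. -/

namespace RealBundle

variable {n : ℕ} {M : Type w} [TopologicalSpace M] [ChartedSpace (EuclideanSpace ℝ (Fin n)) M]

/-- The fibre coordinates of `W` in the preferred trivialization at `p`. -/
def coord (W : RealBundle.{u, v, w} M) (p x : M) : W.V x →L[ℝ] W.F :=
  (trivializationAt W.F W.V p).continuousLinearMapAt ℝ x

/-- The part of the preferred chart at `p` over which `W` is trivialized. -/
def repDom (n : ℕ) {M : Type w} [TopologicalSpace M]
    [ChartedSpace (EuclideanSpace ℝ (Fin n)) M] (W : RealBundle.{u, v, w} M) (p : M) :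
    Set (EuclideanSpace ℝ (Fin n)) :=
  (chartAt (EuclideanSpace ℝ (Fin n)) p).target ∩
    (chartAt (EuclideanSpace ℝ (Fin n)) p).symm ⁻¹' (trivializationAt W.F W.V p).baseSet

/-- A section of `W` in the preferred chart and trivialization at `p`. -/
def rep (n : ℕ) {M : Type w} [TopologicalSpace M]
    [ChartedSpace (EuclideanSpace ℝ (Fin n)) M] (W : RealBundle.{u, v, w} M) (p : M)
    (τ : Π x, W.V x) (y : EuclideanSpace ℝ (Fin n)) : W.F :=
  W.coord p ((chartAt (EuclideanSpace ℝ (Fin n)) p).symm y)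
    (τ ((chartAt (EuclideanSpace ℝ (Fin n)) p).symm y))

lemma coord_eq (W : RealBundle.{u, v, w} M) {p x : M}
    (hx : x ∈ (trivializationAt W.F W.V p).baseSet) (z : W.V x) :
    W.coord p x z = (trivializationAt W.F W.V p ⟨x, z⟩).2 := by
  rw [coord, Trivialization.continuousLinearMapAt_apply, Trivialization.coe_linearMapAt_of_mem _ hx]

lemma isOpen_repDom (W : RealBundle.{u, v, w} M) (p : M) : IsOpen (repDom n W p) :=
  (chartAt (EuclideanSpace ℝ (Fin n)) p).isOpen_inter_preimage_symm
    (trivializationAt W.F W.V p).open_baseSet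

lemma chartAt_mem_repDom (W : RealBundle.{u, v, w} M) {p x : M}
    (hx : x ∈ (chartAt (EuclideanSpace ℝ (Fin n)) p).source)
    (hx' : x ∈ (trivializationAt W.F W.V p).baseSet) :
    chartAt (EuclideanSpace ℝ (Fin n)) p x ∈ repDom n W p := by
  refine ⟨(chartAt _ p).map_source hx, ?_⟩
  rwa [mem_preimage, (chartAt _ p).left_inv hx]

lemma self_mem_repDom (W : RealBundle.{u, v, w} M) (p : M) :
    chartAt (EuclideanSpace ℝ (Fin n)) p p ∈ repDom n W p :=
  W.chartAt_mem_repDom (mem_chart_source _ p) (FiberBundle.mem_baseSet_trivializationAt' p)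

variable [IsManifold (𝓡 n) ∞ M]

lemma cotangentTensor_baseSet (W : RealBundle.{u, v, w} M) (p : M) :
    (trivializationAt (cotangentTensor n W).F (cotangentTensor n W).V p).baseSet =
      (chartAt (EuclideanSpace ℝ (Fin n)) p).source ∩ (trivializationAt W.F W.V p).baseSet := by
  have := TangentBundle.trivializationAt_baseSet (I := 𝓡 n) p
  rw [← this]
  rfl

lemma repDom_cotangentTensor (W : RealBundle.{u, v, w} M) (p : M) :
    repDom n (cotangentTensor n W) p = repDom n W p := by
  ext y
  simp only [repDom, cotangentTensor_baseSet, mem_inter_iff, mem_preimage]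
  exact ⟨fun h => ⟨h.1, h.2.2⟩, fun h => ⟨h.1, (chartAt _ p).map_target h.1, h.2⟩⟩

/-- The tangent vector at `x` with given coordinates in the preferred chart at `p`. -/
def vec (p x : M) : EuclideanSpace ℝ (Fin n) →L[ℝ] TangentSpace (𝓡 n) x :=
  (trivializationAt (EuclideanSpace ℝ (Fin n)) (TangentSpace (𝓡 n) : M → Type) p).symmL ℝ x

/-- The coordinates of an element of a fibre of `T*M ⊗ W`, as a linear map. -/
def coordHom (W : RealBundle.{u, v, w} M) (p x : M) (φ : TangentSpace (𝓡 n) x →L[ℝ] W.V x) :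
    EuclideanSpace ℝ (Fin n) →L[ℝ] W.F :=
  (cotangentTensor n W).coord p x φ

/-- A section of `T*M ⊗ W` in coordinates, as a family of linear maps. -/
def repHom (W : RealBundle.{u, v, w} M) (p : M)
    (φ : Π x : M, TangentSpace (𝓡 n) x →L[ℝ] W.V x) (y : EuclideanSpace ℝ (Fin n)) :
    EuclideanSpace ℝ (Fin n) →L[ℝ] W.F :=
  rep n (cotangentTensor n W) p φ y

lemma coordHom_apply (W : RealBundle.{u, v, w} M) {p x : M}
    (hx : x ∈ (chartAt (EuclideanSpace ℝ (Fin n)) p).source)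
    (hx' : x ∈ (trivializationAt W.F W.V p).baseSet)
    (φ : TangentSpace (𝓡 n) x →L[ℝ] W.V x) (ξ : EuclideanSpace ℝ (Fin n)) :
    W.coordHom p x φ ξ =
      W.coord p x (φ (vec p x ξ)) := by
  have h : x ∈ (trivializationAt (cotangentTensor n W).F (cotangentTensor n W).V p).baseSet := by
    rw [cotangentTensor_baseSet]
    exact ⟨hx, hx'⟩
  exact DFunLike.congr_fun (show W.coordHom p x φ = (W.coord p x).comp (φ.comp (vec p x)) from
    coord_eq (cotangentTensor n W) h φ) ξ

lemma repHom_apply (W : RealBundle.{u, v, w} M) {p : M} {y : EuclideanSpace ℝ (Fin n)}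
    (hy : y ∈ repDom n W p) (φ : Π x : M, TangentSpace (𝓡 n) x →L[ℝ] W.V x)
    (ξ : EuclideanSpace ℝ (Fin n)) :
    W.repHom p φ y ξ =
      W.coord p ((chartAt (EuclideanSpace ℝ (Fin n)) p).symm y)
        (φ ((chartAt (EuclideanSpace ℝ (Fin n)) p).symm y)
          (vec p ((chartAt (EuclideanSpace ℝ (Fin n)) p).symm y) ξ)) :=
  coordHom_apply W ((chartAt _ p).map_target hy.1) hy.2 _ _

/-- The operator `nab` on sections of `W` is `d + Γ` in the preferred chart and trivialization at
`p`, with smooth `Γ`. -/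
def HasChristoffel (W : RealBundle.{u, v, w} M)
    (nab : (Π x : M, W.V x) → Π x : M, TangentSpace (𝓡 n) x →L[ℝ] W.V x) (p : M)
    (Γ : EuclideanSpace ℝ (Fin n) → W.F →L[ℝ] EuclideanSpace ℝ (Fin n) →L[ℝ] W.F) : Prop :=
  ContDiffOn ℝ ∞ Γ (repDom n W p) ∧
    ∀ τ : Π x, W.V x, ∀ y ∈ repDom n W p, DifferentiableAt ℝ (rep n W p τ) y →
      W.repHom p (nab τ) y = fderiv ℝ (rep n W p τ) y + Γ y (rep n W p τ y)

/-- The derivative of a function along the tangent vector with coordinates `ξ`. -/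
lemma mvfderiv_vec {G : Type*} [NormedAddCommGroup G] [NormedSpace ℝ G] {p : M}
    {y : EuclideanSpace ℝ (Fin n)} (hy : y ∈ (chartAt (EuclideanSpace ℝ (Fin n)) p).target)
    {g : M → G} (hg : MDifferentiableAt (𝓡 n) 𝓘(ℝ, G) g
      ((chartAt (EuclideanSpace ℝ (Fin n)) p).symm y)) (ξ : EuclideanSpace ℝ (Fin n)) :
    mvfderiv (𝓡 n) g ((chartAt (EuclideanSpace ℝ (Fin n)) p).symm y)
        (vec p ((chartAt (EuclideanSpace ℝ (Fin n)) p).symm y) ξ) =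
      fderiv ℝ (g ∘ (chartAt (EuclideanSpace ℝ (Fin n)) p).symm) y ξ := by
  set c := chartAt (EuclideanSpace ℝ (Fin n)) p with hc
  have h1 : MDifferentiableAt (𝓡 n) (𝓡 n) c.symm y :=
    mdifferentiableAt_atlas_symm (chart_mem_atlas _ p) hy
  have h2 := mfderiv_comp y (I'' := 𝓘(ℝ, G)) (g := g) hg h1
  rw [mfderiv_eq_fderiv] at h2
  -- The tangent trivialization at p is inverse to the derivative of the inverse chart, so the claim
  -- is the chain rule.
  have h3 : vec p (c.symm y) = mfderiv (𝓡 n) (𝓡 n) c.symm y := by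
    rw [vec, TangentBundle.symmL_trivializationAt (c.map_target hy)]
    have h4 : extChartAt (𝓡 n) p (c.symm y) = y := by
      simp [hc.symm, c.right_inv hy]
    rw [h4]
    simp only [modelWithCornersSelf_coe, range_id, mfderivWithin_univ]
    rfl
  rw [h3, h2]
  rfl

end RealBundle

/-! ### The Leibniz rule for a tensor product connection in a moving frame. -/

section LinearAlgebra

variable {E F ι : Type*} [NormedAddCommGroup E] [NormedSpace ℝ E] [NormedAddCommGroup F]
  [NormedSpace ℝ F] [Fintype ι]

/-- The coefficients of the tensor product of the connections with coefficients `Γ` on the cotangent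
bundle and `Γ'` on a bundle with fibre `F`; here `b` is a basis of `E` with dual basis `β`. -/
def tensorChristoffel (b : ι → E) (β : ι → E →L[ℝ] ℝ)
    (Γ : (E →L[ℝ] ℝ) →L[ℝ] E →L[ℝ] E →L[ℝ] ℝ) (Γ' : F →L[ℝ] E →L[ℝ] F) :
    (E →L[ℝ] F) →L[ℝ] E →L[ℝ] E →L[ℝ] F :=
  (ContinuousLinearMap.flipₗᵢ ℝ E E F : (E →L[ℝ] E →L[ℝ] F) →L[ℝ] E →L[ℝ] E →L[ℝ] F).comp
    (ContinuousLinearMap.compL ℝ E F _ Γ') +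
  ∑ i, (ContinuousLinearMap.flip ((ContinuousLinearMap.smulRightL ℝ E F).comp (Γ (β i)))).comp
    (ContinuousLinearMap.apply ℝ F (b i))

lemma tensorChristoffel_apply (b : ι → E) (β : ι → E →L[ℝ] ℝ)
    (Γ : (E →L[ℝ] ℝ) →L[ℝ] E →L[ℝ] E →L[ℝ] ℝ) (Γ' : F →L[ℝ] E →L[ℝ] F)
    (φ : E →L[ℝ] F) (ξ v : E) :
    tensorChristoffel b β Γ Γ' φ ξ v = Γ' (φ v) ξ + ∑ i, Γ (β i) ξ v • φ (b i) := by
  simp [tensorChristoffel, sum_apply]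

lemma contDiffOn_tensorChristoffel (b : ι → E) (β : ι → E →L[ℝ] ℝ) {V : Set E}
    {Γ : E → (E →L[ℝ] ℝ) →L[ℝ] E →L[ℝ] E →L[ℝ] ℝ} {Γ' : E → F →L[ℝ] E →L[ℝ] F}
    (hΓ : ContDiffOn ℝ ∞ Γ V) (hΓ' : ContDiffOn ℝ ∞ Γ' V) :
    ContDiffOn ℝ ∞ (fun y => tensorChristoffel b β (Γ y) (Γ' y)) V := by
  unfold tensorChristoffel
  refine ContDiffOn.add ?_ (ContDiffOn.sum fun i _ => ?_)
  · exact contDiffOn_const.clm_comp ((ContinuousLinearMap.contDiff _).comp_contDiffOn hΓ')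
  · refine ContDiffOn.clm_comp ?_ contDiffOn_const
    exact (ContinuousLinearMap.flipₗᵢ ℝ E F (E →L[ℝ] F)).contDiff.comp_contDiffOn
      (contDiffOn_const.clm_comp (hΓ.clm_apply contDiffOn_const))

/-- The Leibniz rule for the tensor product connection, computed in a moving frame `a` with dual
coframe `α`, does not depend on the frame. -/
lemma sum_leibniz_eq {b : ι → E} {β : ι → E →L[ℝ] ℝ} (hb : ∀ v, ∑ i, β i v • b i = v)
    {y : E} {α : ι → E → E →L[ℝ] ℝ} {a : ι → E → E}
    (hα : ∀ i, DifferentiableAt ℝ (α i) y) (ha : ∀ i, DifferentiableAt ℝ (a i) y)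
    (hαa : ∀ v, ∀ᶠ z in 𝓝 y, ∑ i, α i z v • a i z = v)
    {φ : E → E →L[ℝ] F} (hφ : DifferentiableAt ℝ φ y)
    (Γ : (E →L[ℝ] ℝ) →L[ℝ] E →L[ℝ] E →L[ℝ] ℝ) (Γ' : F →L[ℝ] E →L[ℝ] F) (ξ v : E) :
    ∑ i, ((fderiv ℝ (α i) y + Γ (α i y)) ξ v • φ y (a i y) +
        α i y v • (fderiv ℝ (fun z => φ z (a i z)) y + Γ' (φ y (a i y))) ξ) =
      (fderiv ℝ φ y + tensorChristoffel b β Γ Γ' (φ y)) ξ v := by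
  have hy : ∀ v, ∑ i, α i y v • a i y = v := fun v => (hαa v).self_of_nhds
  -- Differentiating the constant ∑ αᵢ(v) aᵢ = v shows that the terms containing derivatives of the
  -- frame and of the coframe cancel.
  have hd : ∑ i, (fderiv ℝ (α i) y ξ v • a i y + α i y v • fderiv ℝ (a i) y ξ) = 0 := by
    have h1 : HasFDerivAt (fun z => ∑ i, α i z v • a i z)
        (∑ i, (α i y v • fderiv ℝ (a i) y +
          ((fderiv ℝ (α i) y).flip v).smulRight (a i y))) y := by
      refine HasFDerivAt.fun_sum fun i _ => ?_
      have h0 : HasFDerivAt (fun z => α i z v) ((fderiv ℝ (α i) y).flip v) y := by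
        simpa using (hα i).hasFDerivAt.clm_apply (hasFDerivAt_const v y)
      exact h0.smul (ha i).hasFDerivAt
    have h2 : HasFDerivAt (fun z => ∑ i, α i z v • a i z) (0 : E →L[ℝ] E) y :=
      (hasFDerivAt_const v y).congr_of_eventuallyEq (hαa v)
    have h3 := DFunLike.congr_fun (h1.unique h2) ξ
    simp only [sum_apply, add_apply, smul_apply,
      ContinuousLinearMap.smulRight_apply, ContinuousLinearMap.flip_apply, zero_apply] at h3
    rw [← h3]
    exact Finset.sum_congr rfl fun i _ => add_comm _ _
  have hsum : ∀ ψ : E →L[ℝ] F, ∑ i, α i y v • ψ (a i y) = ψ v := by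
    intro ψ
    conv_rhs => rw [← hy v]
    simp
  -- ∑ αᵢ ⊗ aᵢ is the identity tensor in any frame, so the moving frame may be replaced by the
  -- constant one.
  have hΓ : ∑ i, Γ (α i y) ξ v • φ y (a i y) = ∑ j, Γ (β j) ξ v • φ y (b j) := by
    have hexp : ∀ i, α i y = ∑ j, α i y (b j) • β j := by
      intro i
      ext u
      conv_lhs => rw [← hb u]
      simp [sum_apply, mul_comm]
    calc ∑ i, Γ (α i y) ξ v • φ y (a i y)
        = ∑ i, ∑ j, Γ (β j) ξ v • φ y (α i y (b j) • a i y) := by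
          refine Finset.sum_congr rfl fun i _ => ?_
          conv_lhs => rw [hexp i]
          simp only [map_sum, map_smul, sum_apply, smul_apply, Finset.sum_smul]
          refine Finset.sum_congr rfl fun j _ => ?_
          rw [smul_eq_mul, mul_comm, mul_smul]
      _ = _ := by
          rw [Finset.sum_comm]
          refine Finset.sum_congr rfl fun j _ => ?_
          rw [← Finset.smul_sum, ← map_sum, hy]
  have hprod : ∀ i, fderiv ℝ (fun z => φ z (a i z)) y ξ =
      φ y (fderiv ℝ (a i) y ξ) + fderiv ℝ φ y ξ (a i y) := by
    intro i
    rw [(hφ.hasFDerivAt.clm_apply (ha i).hasFDerivAt).fderiv]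
    simp
  have hΓ' := hsum ((Γ'.comp (φ y)).flip ξ)
  have hφ' := hsum (fderiv ℝ φ y ξ)
  have hd' := congrArg (φ y) hd
  simp only [map_sum, map_add, map_smul, map_zero, Finset.sum_add_distrib] at hd'
  simp only [ContinuousLinearMap.flip_apply, ContinuousLinearMap.comp_apply] at hΓ'
  simp only [add_apply, tensorChristoffel_apply, hprod, add_smul, smul_add,
    Finset.sum_add_distrib]
  rw [hΓ, hφ', hΓ']
  have key : ∀ A B C D G : F, A + B = 0 → A + C + (B + D + G) = D + (G + C) := by
    intro A B C D G h
    rw [eq_neg_of_add_eq_zero_left h]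
    abel
  exact key _ _ _ _ _ hd'

end LinearAlgebra

/-! ### The tensor product connection in a chart. -/

namespace RealBundle

variable {n : ℕ} {M : Type w} [TopologicalSpace M] [ChartedSpace (EuclideanSpace ℝ (Fin n)) M]

/-- The trivial line bundle. -/
def line (M : Type w) [TopologicalSpace M] : RealBundle.{0, 0, w} M := RealBundle.mk ℝ (Trivial M ℝ)

lemma coord_line (p x : M) (t : ℝ) : (line M).coord p x t = t :=
  coord_eq (line M) (mem_univ x) t

variable [IsManifold (𝓡 n) ∞ M]

/-- The coordinate change of the tangent bundle from the chart at `x` to the chart at `p'`, in the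
chart at `p`. -/
def tangentChange (p x p' : M) (z : EuclideanSpace ℝ (Fin n)) :
    EuclideanSpace ℝ (Fin n) →L[ℝ] EuclideanSpace ℝ (Fin n) :=
  Trivialization.coordChangeL ℝ
    (trivializationAt (EuclideanSpace ℝ (Fin n)) (TangentSpace (𝓡 n) : M → Type) x)
    (trivializationAt (EuclideanSpace ℝ (Fin n)) (TangentSpace (𝓡 n) : M → Type) p')
    ((chartAt (EuclideanSpace ℝ (Fin n)) p).symm z)

lemma contMDiffAt_chartAt_symm {p : M} {y : EuclideanSpace ℝ (Fin n)}
    (hy : y ∈ (chartAt (EuclideanSpace ℝ (Fin n)) p).target) :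
    ContMDiffAt (𝓡 n) (𝓡 n) ∞ (chartAt (EuclideanSpace ℝ (Fin n)) p).symm y :=
  (contMDiffOn_chart_symm y hy).contMDiffAt ((chartAt _ p).open_target.mem_nhds hy)

lemma differentiableAt_tangentChange {p x p' : M} {y : EuclideanSpace ℝ (Fin n)}
    (hy : y ∈ (chartAt (EuclideanSpace ℝ (Fin n)) p).target)
    (hx : (chartAt (EuclideanSpace ℝ (Fin n)) p).symm y ∈
      (chartAt (EuclideanSpace ℝ (Fin n)) x).source)
    (hx' : (chartAt (EuclideanSpace ℝ (Fin n)) p).symm y ∈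
      (chartAt (EuclideanSpace ℝ (Fin n)) p').source) :
    DifferentiableAt ℝ (tangentChange p x p') y := by
  have h1 := contMDiffAt_coordChangeL (n := 1) (IB := 𝓡 n)
    (e := trivializationAt (EuclideanSpace ℝ (Fin n)) (TangentSpace (𝓡 n) : M → Type) x)
    (e' := trivializationAt (EuclideanSpace ℝ (Fin n)) (TangentSpace (𝓡 n) : M → Type) p')
    (x := (chartAt (EuclideanSpace ℝ (Fin n)) p).symm y)
    (by rwa [TangentBundle.trivializationAt_baseSet])
    (by rwa [TangentBundle.trivializationAt_baseSet])
  have h2 := h1.comp y ((contMDiffAt_chartAt_symm hy).of_le (by simp))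
  exact (contMDiffAt_iff_contDiffAt.1 h2).differentiableAt (by simp)

lemma tangentChange_apply {p x p' : M} {z : EuclideanSpace ℝ (Fin n)}
    (hx : (chartAt (EuclideanSpace ℝ (Fin n)) p).symm z ∈
      (chartAt (EuclideanSpace ℝ (Fin n)) x).source)
    (hx' : (chartAt (EuclideanSpace ℝ (Fin n)) p).symm z ∈
      (chartAt (EuclideanSpace ℝ (Fin n)) p').source) (ξ : EuclideanSpace ℝ (Fin n)) :
    tangentChange p x p' z ξ =
      (trivializationAt (EuclideanSpace ℝ (Fin n)) (TangentSpace (𝓡 n) : M → Type)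
        p').continuousLinearMapAt ℝ ((chartAt (EuclideanSpace ℝ (Fin n)) p).symm z)
        (vec x ((chartAt (EuclideanSpace ℝ (Fin n)) p).symm z) ξ) := by
  rw [← TangentBundle.trivializationAt_baseSet (I := 𝓡 n)] at hx hx'
  rw [Trivialization.continuousLinearMapAt_apply, Trivialization.coe_linearMapAt_of_mem _ hx']
  refine (Trivialization.coordChangeL_apply (R := ℝ) _ _ ⟨hx, hx'⟩ ξ).trans ?_
  exact congrArg (fun ζ => ((trivializationAt (EuclideanSpace ℝ (Fin n))
    (TangentSpace (𝓡 n) : M → Type) p') ⟨_, ζ⟩).2) 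
    (Trivialization.symmL_apply (R := ℝ) _ hx ξ).symm

lemma vec_continuousLinearMapAt {p x : M} (hx : x ∈ (chartAt (EuclideanSpace ℝ (Fin n)) p).source)
    (ξ : TangentSpace (𝓡 n) x) :
    vec p x ((trivializationAt (EuclideanSpace ℝ (Fin n)) (TangentSpace (𝓡 n) : M → Type)
      p).continuousLinearMapAt ℝ x ξ) = ξ := by
  rw [← TangentBundle.trivializationAt_baseSet (I := 𝓡 n)] at hx
  exact Trivialization.symmL_continuousLinearMapAt _ hx ξ

lemma tangentChange_self {p x p' : M} {z : EuclideanSpace ℝ (Fin n)}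
    (hx : (chartAt (EuclideanSpace ℝ (Fin n)) p).symm z ∈
      (chartAt (EuclideanSpace ℝ (Fin n)) x).source)
    (hx' : (chartAt (EuclideanSpace ℝ (Fin n)) p).symm z ∈
      (chartAt (EuclideanSpace ℝ (Fin n)) p').source) (ξ : EuclideanSpace ℝ (Fin n)) :
    tangentChange p x p' z (tangentChange p p' x z ξ) = ξ := by
  rw [tangentChange_apply hx hx', tangentChange_apply hx' hx, vec_continuousLinearMapAt hx]
  rw [← TangentBundle.trivializationAt_baseSet (I := 𝓡 n)] at hx'
  exact Trivialization.continuousLinearMapAt_symmL _ hx' ξ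

lemma sum_proj_smul_single (v : EuclideanSpace ℝ (Fin n)) :
    ∑ i, (EuclideanSpace.proj i : EuclideanSpace ℝ (Fin n) →L[ℝ] ℝ) v •
      (EuclideanSpace.single i (1 : ℝ) : EuclideanSpace ℝ (Fin n)) = v := by
  simpa using (EuclideanSpace.basisFun (Fin n) ℝ).sum_repr v

/-- The occurrences of `id` make elements of the fibres of the trivial line bundle readable as real
numbers, so that they can act as scalars. -/
lemma tensorConnection_apply {W : RealBundle.{u, v, w} M}
    (nabla : (Π x : M, TangentSpace (𝓡 n) x →L[ℝ] Trivial M ℝ x) →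
      Π x : M, TangentSpace (𝓡 n) x →L[ℝ] (TangentSpace (𝓡 n) x →L[ℝ] Trivial M ℝ x))
    (nabla' : (Π x : M, W.V x) → Π x : M, TangentSpace (𝓡 n) x →L[ℝ] W.V x)
    (φ : Π x : M, TangentSpace (𝓡 n) x →L[ℝ] W.V x) (x : M) (ξ v : TangentSpace (𝓡 n) x) :
    tensorConnection nabla nabla' φ x ξ v = ∑ i : Fin n,
      ((id (nabla (coframe x i) x ξ v) : ℝ) • φ x (frame x i x) +
        (id (coframe x i x v) : ℝ) • nabla' (fun y => φ y (frame x i y)) x ξ) := by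
  change (∑ i : Fin n, ((tmul (nabla (coframe x i) x ξ) (φ x (frame x i x)) :
            TangentSpace (𝓡 n) x →L[ℝ] W.V x) +
          tmul (coframe x i x) (nabla' (fun y => φ y (frame x i y)) x ξ))) v = _
  rw [sum_apply]
  rfl

/-- The tensor product of operators of the form `d + Γ` is of this form. -/
theorem HasChristoffel.tensorConnection {W : RealBundle.{u, v, w} M}
    {nabla : (Π x : M, TangentSpace (𝓡 n) x →L[ℝ] Trivial M ℝ x) →
      Π x : M, TangentSpace (𝓡 n) x →L[ℝ] (TangentSpace (𝓡 n) x →L[ℝ] Trivial M ℝ x)}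
    {nabla' : (Π x : M, W.V x) → Π x : M, TangentSpace (𝓡 n) x →L[ℝ] W.V x} {p : M}
    {Γ : EuclideanSpace ℝ (Fin n) → (EuclideanSpace ℝ (Fin n) →L[ℝ] ℝ) →L[ℝ]
      EuclideanSpace ℝ (Fin n) →L[ℝ] EuclideanSpace ℝ (Fin n) →L[ℝ] ℝ}
    {Γ' : EuclideanSpace ℝ (Fin n) → W.F →L[ℝ] EuclideanSpace ℝ (Fin n) →L[ℝ] W.F}
    (h : HasChristoffel (cotangentTensor n (line M)) nabla p Γ) (h' : HasChristoffel W nabla' p Γ') :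
    HasChristoffel (cotangentTensor n W) (RealBundle.tensorConnection nabla nabla') p
      (fun y => tensorChristoffel (fun i => EuclideanSpace.single i (1 : ℝ))
        (fun i => EuclideanSpace.proj i) (Γ y) (Γ' y)) := by
  have hline : ∀ {y}, y ∈ repDom n W p → y ∈ repDom n (cotangentTensor n (line M)) p := by
    intro y hy
    rw [repDom_cotangentTensor]
    exact ⟨hy.1, mem_univ _⟩
  refine ⟨?_, ?_⟩
  · rw [repDom_cotangentTensor]
    exact contDiffOn_tensorChristoffel _ _ (h.1.mono fun y hy => hline hy) h'.1
  intro (φ : Π x : M, TangentSpace (𝓡 n) x →L[ℝ] W.V x) y hy hφ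
  rw [repDom_cotangentTensor] at hy
  set c := chartAt (EuclideanSpace ℝ (Fin n)) p with hc
  set x := c.symm y with hx
  have hxp : x ∈ c.source := c.map_target hy.1
  have hxx : x ∈ (chartAt (EuclideanSpace ℝ (Fin n)) x).source := mem_chart_source _ x
  have hev : ∀ᶠ z in 𝓝 y, z ∈ repDom n W p ∧
      c.symm z ∈ (chartAt (EuclideanSpace ℝ (Fin n)) x).source := by
    refine ((isOpen_repDom W p).eventually_mem hy).and ?_
    exact (c.continuousAt_symm hy.1).eventually_mem
      ((chartAt (EuclideanSpace ℝ (Fin n)) x).open_source.mem_nhds hxx)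
  -- At x the definition of `tensorConnection` uses the frame of the preferred chart at x, not of
  -- the chart at p. Seen from p this is a moving frame `a` with dual coframe `α`, which is the
  -- situation of `sum_leibniz_eq`.
  let α : Fin n → EuclideanSpace ℝ (Fin n) → EuclideanSpace ℝ (Fin n) →L[ℝ] ℝ := fun i =>
    (line M).repHom p (coframe x i)
  let a : Fin n → EuclideanSpace ℝ (Fin n) → EuclideanSpace ℝ (Fin n) := fun i z =>
    tangentChange p x p z (EuclideanSpace.single i 1)
  let Φ : EuclideanSpace ℝ (Fin n) → EuclideanSpace ℝ (Fin n) →L[ℝ] W.F := W.repHom p φ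
  have hαz : ∀ i z, z ∈ repDom n W p → c.symm z ∈ (chartAt (EuclideanSpace ℝ (Fin n)) x).source →
      α i z = (EuclideanSpace.proj i : EuclideanSpace ℝ (Fin n) →L[ℝ] ℝ).comp
        (tangentChange p p x z) := by
    intro i z hz hz'
    ext v
    rw [ContinuousLinearMap.comp_apply, tangentChange_apply (c.map_target hz.1) hz']
    exact (repHom_apply (line M) ⟨hz.1, mem_univ _⟩ _ _).trans (coord_line _ _ _)
  have hΦz : ∀ i z, z ∈ repDom n W p → c.symm z ∈ (chartAt (EuclideanSpace ℝ (Fin n)) x).source →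
      rep n W p (fun x' => φ x' (frame x i x')) z = Φ z (a i z) := by
    intro i z hz hz'
    simp only [Φ, a]
    rw [repHom_apply W hz, tangentChange_apply hz' (c.map_target hz.1),
      vec_continuousLinearMapAt (c.map_target hz.1)]
    rfl
  have ha : ∀ i, DifferentiableAt ℝ (a i) y := fun i =>
    (differentiableAt_tangentChange hy.1 hxx hxp).clm_apply (differentiableAt_const _)
  have hα : ∀ i, DifferentiableAt ℝ (α i) y := fun i =>
    ((differentiableAt_const _).clm_comp
      (differentiableAt_tangentChange hy.1 hxp hxx)).congr_of_eventuallyEq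
      (hev.mono fun z hz => hαz i z hz.1 hz.2)
  have hαa : ∀ v, ∀ᶠ z in 𝓝 y, ∑ i, α i z v • a i z = v := by
    intro v
    refine hev.mono fun z hz => ?_
    have h1 : ∀ i, α i z v • a i z = tangentChange p x p z
        ((EuclideanSpace.proj i : EuclideanSpace ℝ (Fin n) →L[ℝ] ℝ) (tangentChange p p x z v) •
          EuclideanSpace.single i 1) := by
      intro i
      rw [hαz i z hz.1 hz.2, map_smul]
      rfl
    rw [Finset.sum_congr rfl fun i _ => h1 i, ← map_sum, sum_proj_smul_single,
      tangentChange_self hz.2 (c.map_target hz.1.1)]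
  have hΦ : DifferentiableAt ℝ Φ y := hφ
  have hrepd : ∀ i, rep n W p (fun x' => φ x' (frame x i x')) =ᶠ[𝓝 y] fun z => Φ z (a i z) :=
    fun i => hev.mono fun z hz => hΦz i z hz.1 hz.2
  have key := sum_leibniz_eq sum_proj_smul_single hα ha hαa hΦ (Γ y) (Γ' y)
  refine ContinuousLinearMap.ext fun ξ => ContinuousLinearMap.ext fun v => ?_
  refine Eq.trans ?_ (key ξ v)
  have e1 : (cotangentTensor n W).repHom p (RealBundle.tensorConnection nabla nabla' φ) y ξ =
      W.coordHom p x (RealBundle.tensorConnection nabla nabla' φ x (vec p x ξ)) :=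
    repHom_apply (cotangentTensor n W) (by rwa [repDom_cotangentTensor]) _ _
  have e2 : W.coordHom p x (RealBundle.tensorConnection nabla nabla' φ x (vec p x ξ)) v =
      W.coord p x (RealBundle.tensorConnection nabla nabla' φ x (vec p x ξ) (vec p x v)) :=
    coordHom_apply W hxp hy.2 _ _
  refine (congrArg (fun ψ : EuclideanSpace ℝ (Fin n) →L[ℝ] W.F => ψ v) e1).trans (e2.trans ?_)
  rw [tensorConnection_apply, map_sum]
  refine Finset.sum_congr rfl fun i _ => ?_
  rw [map_add, map_smul, map_smul]
  have f1 : (id (nabla (coframe x i) x (vec p x ξ) (vec p x v)) : ℝ) =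
      (fderiv ℝ (α i) y + Γ y (α i y)) ξ v := by
    have := h.2 (coframe x i) y (hline hy) (hα i)
    rw [← show (cotangentTensor n (line M)).repHom p (nabla (coframe x i)) y =
      fderiv ℝ (α i) y + Γ y (α i y) from this]
    have g1 : (cotangentTensor n (line M)).repHom p (nabla (coframe x i)) y ξ =
        (line M).coordHom p x (nabla (coframe x i) x (vec p x ξ)) :=
      repHom_apply (cotangentTensor n (line M)) (hline hy) _ _
    have g2 : (line M).coordHom p x (nabla (coframe x i) x (vec p x ξ)) v =
        (line M).coord p x (nabla (coframe x i) x (vec p x ξ) (vec p x v)) :=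
      coordHom_apply (line M) hxp (mem_univ _) _ _
    exact ((congrArg (fun ψ : EuclideanSpace ℝ (Fin n) →L[ℝ] ℝ => ψ v) g1).trans
      (g2.trans (coord_line _ _ _))).symm
  have f2 : (id (coframe x i x (vec p x v)) : ℝ) = α i y v :=
    ((repHom_apply (line M) ⟨hy.1, mem_univ _⟩ _ _).trans (coord_line _ _ _)).symm
  have f3 : W.coord p x (φ x (frame x i x)) = Φ y (a i y) := hΦz i y hy hxx
  have f4 : W.coord p x (nabla' (fun x' => φ x' (frame x i x')) x (vec p x ξ)) =
      (fderiv ℝ (fun z => Φ z (a i z)) y + Γ' y (Φ y (a i y))) ξ := by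
    have hd : DifferentiableAt ℝ (fun z => Φ z (a i z)) y := hΦ.clm_apply (ha i)
    have := h'.2 _ y hy (hd.congr_of_eventuallyEq (hrepd i))
    rw [(hrepd i).fderiv_eq, (hrepd i).self_of_nhds] at this
    rw [← this]
    exact (repHom_apply W hy _ _).symm
  rw [f1, f2, f3, f4]

end RealBundle

/-! ### The local form d + Γ of a smooth covariant derivative. -/

section CovariantDerivative

variable {n : ℕ} {M : Type w} [TopologicalSpace M] [ChartedSpace (EuclideanSpace ℝ (Fin n)) M]
  {F : Type u} [NormedAddCommGroup F] [NormedSpace ℝ F]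
  {E : M → Type v} [TopologicalSpace (TotalSpace F E)]
  [∀ x, AddCommGroup (E x)] [∀ x, Module ℝ (E x)] [∀ x, TopologicalSpace (E x)]
  [∀ x, IsTopologicalAddGroup (E x)] [∀ x, ContinuousSMul ℝ (E x)]
  [FiberBundle F E] [VectorBundle ℝ F E]

lemma CovariantDerivative.sum_smul (cov : CovariantDerivative (𝓡 n) F E) {ι : Type*} (s : Finset ι)
    {g : ι → M → ℝ} {f : ι → Π x : M, E x} {x : M}
    (hg : ∀ i, MDifferentiableAt (𝓡 n) 𝓘(ℝ, ℝ) (g i) x)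
    (hf : ∀ i, MDifferentiableAt (𝓡 n) ((𝓡 n).prod 𝓘(ℝ, F))
      (fun x => (⟨x, f i x⟩ : TotalSpace F E)) x) :
    cov.toFun (∑ i ∈ s, g i • f i) x =
      ∑ i ∈ s, (g i x • cov.toFun (f i) x + (mvfderiv (𝓡 n) (g i) x).smulRight (f i x)) := by
  classical
  have hgf : ∀ i, MDifferentiableAt (𝓡 n) ((𝓡 n).prod 𝓘(ℝ, F))
      (fun x => (⟨x, (g i • f i) x⟩ : TotalSpace F E)) x := fun i => (hg i).smul_section (hf i)
  induction s using Finset.induction_on with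
  | empty => simp
  | insert i s hi ih =>
    rw [Finset.sum_insert hi, Finset.sum_insert hi,
      cov.isCovariantDerivativeOnUniv.add (hgf i) ?_ (mem_univ x),
      cov.isCovariantDerivativeOnUniv.leibniz (hf i) (hg i) (mem_univ x), ih]
    have := MDifferentiableAt.sum_section (s := s) (t := fun i => g i • f i) (x₀ := x)
      (I := 𝓡 n) (F := F) (fun i _ => hgf i)
    simpa [Finset.sum_apply] using this

variable [IsManifold (𝓡 n) ∞ M]

/-- A smooth covariant derivative of a section that is smooth near a point is smooth near that
point. -/
lemma CovariantDerivative.contMDiffAt_apply [T2Space M] (cov : CovariantDerivative (𝓡 n) F E)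
    [cov.ContMDiffCovariantDerivative ∞] {f : Π x : M, E x} {u : Set M} (hu : IsOpen u)
    (hf : ContMDiffOn (𝓡 n) ((𝓡 n).prod 𝓘(ℝ, F)) ∞ (fun x => (⟨x, f x⟩ : TotalSpace F E)) u)
    {x₀ : M} (hx₀ : x₀ ∈ u) :
    ContMDiffAt (𝓡 n) ((𝓡 n).prod 𝓘(ℝ, EuclideanSpace ℝ (Fin n) →L[ℝ] F)) ∞
      (fun x => (⟨x, cov.toFun f x⟩ : TotalSpace (EuclideanSpace ℝ (Fin n) →L[ℝ] F)
        (fun x : M => TangentSpace (𝓡 n) x →L[ℝ] E x))) x₀ := by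
  obtain ⟨χ, -, hχ⟩ := (SmoothBumpFunction.nhds_basis_tsupport (I := 𝓡 n) x₀).mem_iff.1
    (hu.mem_nhds hx₀)
  -- Smoothness of `cov` is given for sections smooth on all of M, so the local section is cut off
  -- by a bump function.
  have hsm : ContMDiff (𝓡 n) ((𝓡 n).prod 𝓘(ℝ, F)) ∞
      (fun x => (⟨x, ((χ : M → ℝ) • f) x⟩ : TotalSpace F E)) :=
    ContMDiffOn.smul_section_of_tsupport χ.contMDiff.contMDiffOn hu hχ hf
  have hcov := (CovariantDerivative.ContMDiffCovariantDerivative.contMDiff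
    (cov := cov) (k := ∞)).contMDiff (σ := (χ : M → ℝ) • f) (by
      rw [show (∞ : ℕ∞ω) + 1 = ∞ from rfl]
      exact hsm.contMDiffOn)
  refine ((contMDiffOn_univ.1 hcov) x₀).congr_of_eventuallyEq ?_
  -- The value of `cov` at x depends on the germ at x, so the cut-off has to equal 1 near each x
  -- close to x₀.
  have h1 : ∀ᶠ x in 𝓝 x₀, ∀ᶠ x' in 𝓝 x, χ x' = 1 := χ.eventuallyEq_one.eventually_nhds
  filter_upwards [h1, hu.mem_nhds hx₀] with x hx hxu
  have : cov.toFun f x = cov.toFun ((χ : M → ℝ) • f) x := by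
    refine cov.isCovariantDerivativeOnUniv.congr_of_eventuallyEq ?_ ?_ univ_mem ?_
    · exact ((hf x hxu).contMDiffAt (hu.mem_nhds hxu)).mdifferentiableAt (by simp)
    · exact (hsm x).mdifferentiableAt (by simp)
    · filter_upwards [hx] with x' hx'
      simp [hx']
  rw [this]

variable [ContMDiffVectorBundle ∞ F E (𝓡 n)]

/-- A smooth covariant derivative is of the form `d + Γ` in local coordinates. -/
theorem CovariantDerivative.exists_hasChristoffel [T2Space M] [FiniteDimensional ℝ F]
    (cov : CovariantDerivative (𝓡 n) F E) [cov.ContMDiffCovariantDerivative ∞] (p : M) :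
    ∃ Γ, RealBundle.HasChristoffel (RealBundle.mk F E) cov.toFun p Γ := by
  let W : RealBundle M := RealBundle.mk F E
  let e := trivializationAt F E p
  let b := Module.finBasis ℝ F
  let f : Fin (Module.finrank ℝ F) → Π x : M, E x := fun j x => e.symmL ℝ x (b j)
  set c := chartAt (EuclideanSpace ℝ (Fin n)) p with hc
  have hcoord : ∀ {x : M} (z : E x), x ∈ e.baseSet → W.coord p x z = (e ⟨x, z⟩).2 :=
    fun z hx => W.coord_eq hx z
  have hcf : ∀ {x : M} j, x ∈ e.baseSet → W.coord p x (f j x) = b j := fun j hx =>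
    e.continuousLinearMapAt_symmL hx (b j)
  have hf : ∀ j, ContMDiffOn (𝓡 n) ((𝓡 n).prod 𝓘(ℝ, F)) ∞
      (fun x => (⟨x, f j x⟩ : TotalSpace F E)) e.baseSet := by
    intro j
    rw [e.contMDiffOn_section_baseSet_iff]
    refine (contMDiffOn_const (c := b j)).congr fun x hx => ?_
    rw [← hcoord _ hx, hcf j hx]
  have hfd : ∀ j x, x ∈ e.baseSet → MDifferentiableAt (𝓡 n) ((𝓡 n).prod 𝓘(ℝ, F))
      (fun x => (⟨x, f j x⟩ : TotalSpace F E)) x := fun j x hx =>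
    ((hf j x hx).contMDiffAt (e.open_baseSet.mem_nhds hx)).mdifferentiableAt (by simp)
  -- Γ sends fibre coordinates w to ∑ wⱼ ∇fⱼ. The frame fⱼ has the constant coordinates bⱼ, so the
  -- Leibniz rule for τ = ∑ gⱼ fⱼ splits ∇τ into the derivative of the coordinates and this term.
  refine ⟨fun y => ∑ j, (LinearMap.toContinuousLinearMap (b.coord j)).smulRight
    (W.repHom p (cov.toFun (f j)) y), ?_, ?_⟩
  · refine ContDiffOn.sum fun j _ => ?_
    have hs : ContDiffOn ℝ ∞ (W.repHom p (cov.toFun (f j))) (RealBundle.repDom n W p) := by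
      intro y hy
      refine ContDiffAt.contDiffWithinAt ?_
      have hx : c.symm y ∈ e.baseSet := hy.2
      have hx' : c.symm y ∈ (trivializationAt (EuclideanSpace ℝ (Fin n) →L[ℝ] F)
          (fun x : M => TangentSpace (𝓡 n) x →L[ℝ] E x) p).baseSet := by
        have h3 := RealBundle.cotangentTensor_baseSet (n := n) W p
        exact h3.ge ⟨c.map_target hy.1, hx⟩
      have h1 := cov.contMDiffAt_apply e.open_baseSet (hf j) hx
      have h2 := (Trivialization.contMDiffAt_section_iff _ hx').1 h1
      have h3 := contMDiffAt_iff_contDiffAt.1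
        (h2.comp y (RealBundle.contMDiffAt_chartAt_symm hy.1))
      refine h3.congr_of_eventuallyEq ?_
      filter_upwards [(RealBundle.isOpen_repDom W p).mem_nhds hy] with z hz
      refine (RealBundle.cotangentTensor n W).coord_eq ?_ _
      rw [RealBundle.cotangentTensor_baseSet]
      exact ⟨c.map_target hz.1, hz.2⟩
    exact (ContinuousLinearMap.smulRightL ℝ F (EuclideanSpace ℝ (Fin n) →L[ℝ] F)
      (LinearMap.toContinuousLinearMap (b.coord j))).contDiff.comp_contDiffOn hs
  intro τ y hy hτ
  set x := c.symm y with hxdef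
  have hx : x ∈ e.baseSet := hy.2
  have hxc : x ∈ c.source := c.map_target hy.1
  have hcx : c x = y := c.right_inv hy.1
  let g : Fin (Module.finrank ℝ F) → M → ℝ := fun j x' => b.coord j (W.coord p x' (τ x'))
  have hW : MDifferentiableAt (𝓡 n) 𝓘(ℝ, F) (fun x' => W.coord p x' (τ x')) x := by
    have h1 : MDifferentiableAt (𝓡 n) 𝓘(ℝ, F) (RealBundle.rep n W p τ ∘ c) x := by
      refine MDifferentiableAt.comp x (I' := 𝓡 n) ?_
        (mdifferentiableAt_atlas (chart_mem_atlas _ p) hxc)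
      rw [hcx]
      exact hτ.mdifferentiableAt
    refine h1.congr_of_eventuallyEq ?_
    filter_upwards [c.open_source.mem_nhds hxc] with x' hx'
    simp only [Function.comp, RealBundle.rep]
    rw [← hc, c.left_inv hx']
  have hg : ∀ j, MDifferentiableAt (𝓡 n) 𝓘(ℝ, ℝ) (g j) x := fun j =>
    ((LinearMap.toContinuousLinearMap (b.coord j)).differentiableAt.mdifferentiableAt).comp x hW
  have hτd : MDifferentiableAt (𝓡 n) ((𝓡 n).prod 𝓘(ℝ, F))
      (fun x => (⟨x, τ x⟩ : TotalSpace F E)) x := by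
    rw [e.mdifferentiableAt_section_iff (𝓡 n) τ hx]
    refine hW.congr_of_eventuallyEq ?_
    filter_upwards [e.open_baseSet.mem_nhds hx] with x' hx'
    exact (hcoord _ hx').symm
  have hexp : ∀ᶠ x' in 𝓝 x, τ x' = (∑ j, g j • f j) x' := by
    filter_upwards [e.open_baseSet.mem_nhds hx] with x' hx'
    rw [Finset.sum_apply]
    have h1 : e.symmL ℝ x' (W.coord p x' (τ x')) = τ x' :=
      e.symmL_continuousLinearMapAt hx' (τ x')
    rw [← h1]
    conv_lhs => rw [← b.sum_repr (W.coord p x' (τ x')), map_sum]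
    refine Finset.sum_congr rfl fun j _ => ?_
    rw [map_smul]
    rfl
  have hsumd : MDifferentiableAt (𝓡 n) ((𝓡 n).prod 𝓘(ℝ, F))
      (fun x => (⟨x, (∑ j, g j • f j) x⟩ : TotalSpace F E)) x := by
    refine hτd.congr_of_eventuallyEq ?_
    filter_upwards [hexp] with x' hx'
    rw [hx']
  have hcov : cov.toFun τ x = ∑ j, (g j x • cov.toFun (f j) x +
      (mvfderiv (𝓡 n) (g j) x).smulRight (f j x)) := by
    rw [← cov.sum_smul Finset.univ hg fun j => hfd j x hx]
    exact cov.isCovariantDerivativeOnUniv.congr_of_eventuallyEq hτd hsumd univ_mem hexp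
  refine ContinuousLinearMap.ext fun ξ => ?_
  refine (RealBundle.repHom_apply W hy _ _).trans ?_
  change W.coord p x (cov.toFun τ x (RealBundle.vec p x ξ)) = _
  have hdg : ∀ j, mvfderiv (𝓡 n) (g j) x (RealBundle.vec p x ξ) =
      b.coord j (fderiv ℝ (RealBundle.rep n W p τ) y ξ) := by
    intro j
    rw [RealBundle.mvfderiv_vec hy.1 (hg j)]
    have h1 : HasFDerivAt (g j ∘ c.symm) ((LinearMap.toContinuousLinearMap (b.coord j)).comp
        (fderiv ℝ (RealBundle.rep n W p τ) y)) y :=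
      (LinearMap.toContinuousLinearMap (b.coord j)).hasFDerivAt.comp y hτ.hasFDerivAt
    rw [h1.fderiv]
    rfl
  have h1 : cov.toFun τ x (RealBundle.vec p x ξ) = ∑ j,
      (g j x • cov.toFun (f j) x (RealBundle.vec p x ξ) +
        mvfderiv (𝓡 n) (g j) x (RealBundle.vec p x ξ) • f j x) := by
    rw [hcov, sum_apply]
    rfl
  rw [h1]
  refine (map_sum (W.coord p x) _ _).trans ?_
  have h2 : ∀ j, W.coord p x (g j x • cov.toFun (f j) x (RealBundle.vec p x ξ) +
        mvfderiv (𝓡 n) (g j) x (RealBundle.vec p x ξ) • f j x) =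
      b.coord j (RealBundle.rep n W p τ y) • W.repHom p (cov.toFun (f j)) y ξ +
        b.coord j (fderiv ℝ (RealBundle.rep n W p τ) y ξ) • b j := by
    intro j
    refine (map_add (W.coord p x) _ _).trans ?_
    refine congrArg₂ (· + ·) ?_ ?_
    · refine (map_smul (W.coord p x) _ _).trans ?_
      rw [RealBundle.repHom_apply W hy]
      rfl
    · refine (map_smul (W.coord p x) _ _).trans ?_
      rw [hdg j]
      exact congrArg _ (hcf j hx)
  rw [Finset.sum_congr rfl fun j _ => h2 j, Finset.sum_add_distrib, add_comm]
  have h3 : ∑ j, b.coord j (fderiv ℝ (RealBundle.rep n W p τ) y ξ) • b j =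
      fderiv ℝ (RealBundle.rep n W p τ) y ξ := b.sum_repr _
  rw [h3, add_apply, sum_apply, sum_apply]
  rfl

end CovariantDerivative

/-! ### Differential calculus up to the boundary of a half-space. -/

section HalfSpace

variable {E F : Type*} [NormedAddCommGroup E] [NormedSpace ℝ E] [NormedAddCommGroup F]
  [NormedSpace ℝ F]

/-- Near `y`, the diffeomorphism `ψ` with inverse `θ` identifies a closed half-space with `B` and
its interior with `Y`. -/
structure IsHalfSpaceParam (B Y : Set E) (y : E) (l : E →L[ℝ] ℝ) (ψ θ : E → E) (N : Set E) :
    Prop where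
  l_ne_zero : l ≠ 0
  isOpen : IsOpen N
  mem : θ y ∈ N
  contDiffOn : ContDiffOn ℝ 1 ψ N
  differentiableAt : DifferentiableAt ℝ θ y
  right_inv : ∀ᶠ y' in 𝓝 y, ψ (θ y') = y'
  mem_closed : ∀ z ∈ N, 0 ≤ l z → ψ z ∈ B
  mem_open : ∀ z ∈ N, 0 < l z → ψ z ∈ Y
  nonneg : ∀ᶠ y' in 𝓝 y, y' ∈ B → 0 ≤ l (θ y')

namespace IsHalfSpaceParam

variable {B Y : Set E} {y : E} {l : E →L[ℝ] ℝ} {ψ θ : E → E} {N : Set E}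

lemma apply_eq (h : IsHalfSpaceParam B Y y l ψ θ N) : ψ (θ y) = y := h.right_inv.self_of_nhds

lemma hasFDerivAt (h : IsHalfSpaceParam B Y y l ψ θ N) {z : E} (hz : z ∈ N) :
    HasFDerivAt ψ (fderiv ℝ ψ z) z :=
  (((h.contDiffOn z hz).contDiffAt (h.isOpen.mem_nhds hz)).differentiableAt (by simp)).hasFDerivAt

lemma fderiv_comp (h : IsHalfSpaceParam B Y y l ψ θ N) :
    (fderiv ℝ ψ (θ y)).comp (fderiv ℝ θ y) = ContinuousLinearMap.id ℝ E :=
  ((h.hasFDerivAt h.mem).comp y h.differentiableAt.hasFDerivAt).unique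
    ((hasFDerivAt_id y).congr_of_eventuallyEq h.right_inv)

lemma surjective (h : IsHalfSpaceParam B Y y l ψ θ N) : Function.Surjective l := by
  refine LinearMap.surjective (f := (l : E →ₗ[ℝ] ℝ)) fun h0 => h.l_ne_zero ?_
  ext x
  exact DFunLike.congr_fun h0 x

/-- A closed half-space is the closure of its interior, also inside an open set. -/
lemma mem_closure_inter (h : IsHalfSpaceParam B Y y l ψ θ N) {U : Set E} (hU : IsOpen U) {z : E}
    (hz : z ∈ U) (hlz : 0 ≤ l z) : z ∈ closure (U ∩ {z | 0 < l z}) := by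
  refine hU.inter_closure ⟨hz, ?_⟩
  obtain ⟨v, hv⟩ := h.surjective 1
  have h1 : Tendsto (fun t : ℝ => z + t • v) (𝓝[>] 0) (𝓝 z) := by
    have : Continuous fun t : ℝ => z + t • v := by fun_prop
    simpa using (this.tendsto 0).mono_left nhdsWithin_le_nhds
  refine mem_closure_of_tendsto h1 ?_
  filter_upwards [self_mem_nhdsWithin] with t ht
  simp only [map_add, map_smul, hv, smul_eq_mul, mul_one]
  exact add_pos_of_nonneg_of_pos hlz ht

/-- A half-ball is convex with nonempty interior, hence has unique derivatives at `θ y`. The map ψ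
sends it into B, and its derivative there is onto because it has a right inverse. -/
lemma uniqueDiffWithinAt (h : IsHalfSpaceParam B Y y l ψ θ N) (hy : y ∈ B) :
    UniqueDiffWithinAt ℝ B y := by
  obtain ⟨r, hr, hrN⟩ := Metric.isOpen_iff.1 h.isOpen _ h.mem
  have hl : 0 ≤ l (θ y) := h.nonneg.self_of_nhds hy
  have hconv : Convex ℝ (Metric.ball (θ y) r ∩ {z | 0 ≤ l z}) :=
    (convex_ball _ _).inter (convex_halfSpace_ge l.toLinearMap.isLinear 0)
  have hcl := h.mem_closure_inter Metric.isOpen_ball (Metric.mem_ball_self hr) hl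
  have hint : (interior (Metric.ball (θ y) r ∩ {z | 0 ≤ l z})).Nonempty := by
    obtain ⟨z, hz⟩ := closure_nonempty_iff.1 ⟨_, hcl⟩
    refine ⟨z, mem_interior.2 ⟨_, ?_, ?_, hz⟩⟩
    · exact fun z hz => ⟨hz.1, (le_of_lt hz.2 : 0 ≤ l z)⟩
    · exact Metric.isOpen_ball.inter (isOpen_lt continuous_const l.continuous)
  have h1 : UniqueDiffWithinAt ℝ (Metric.ball (θ y) r ∩ {z | 0 ≤ l z}) (θ y) :=
    uniqueDiffWithinAt_convex hconv hint (subset_closure ⟨Metric.mem_ball_self hr, hl⟩)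
  have h2 := (h.hasFDerivAt h.mem).hasFDerivWithinAt.uniqueDiffWithinAt h1 ?_
  · rw [h.apply_eq] at h2
    refine h2.mono ?_
    rintro _ ⟨z, hz, rfl⟩
    exact h.mem_closed z (hrN hz.1) hz.2
  · refine Function.Surjective.denseRange fun v => ⟨fderiv ℝ θ y v, ?_⟩
    exact DFunLike.congr_fun h.fderiv_comp v

/-- If the derivative of a function in the interior extends continuously to the boundary, the
extension is the derivative at the boundary. -/
lemma hasFDerivWithinAt (h : IsHalfSpaceParam B Y y l ψ θ N) (hy : y ∈ B) {g : E → F}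
    {G : E → E →L[ℝ] F} (hg : ContinuousOn g B) (hG : ContinuousOn G B)
    (hgG : ∀ y ∈ Y, HasFDerivAt g (G y) y) :
    HasFDerivWithinAt g (G y) B y := by
  obtain ⟨r', hr', hrN'⟩ := Metric.isOpen_iff.1 h.isOpen _ h.mem
  -- The radius is shrunk so that even the closure of the half-ball S stays in N, where ψ is
  -- differentiable.
  obtain ⟨r, hr, hrr⟩ := exists_between hr'
  have hrN : Metric.closedBall (θ y) r ⊆ N := (Metric.closedBall_subset_ball hrr).trans hrN'
  let S : Set E := Metric.ball (θ y) r ∩ {z | 0 < l z}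
  have hSN : S ⊆ N := fun z hz => hrN (Metric.ball_subset_closedBall hz.1)
  have hclS : closure S ⊆ N ∩ {z | 0 ≤ l z} := by
    refine fun z hz => ⟨hrN ?_, ?_⟩
    · exact closure_minimal (inter_subset_left.trans Metric.ball_subset_closedBall)
        Metric.isClosed_closedBall hz
    · exact closure_minimal (fun z (hz : z ∈ S) => (le_of_lt hz.2 : 0 ≤ l z))
        (isClosed_le continuous_const l.continuous) hz
  have hmaps : MapsTo ψ S B := fun z hz => h.mem_closed z (hSN hz) (le_of_lt hz.2)
  have hcomp : ∀ z ∈ S, HasFDerivAt (g ∘ ψ) ((G (ψ z)).comp (fderiv ℝ ψ z)) z := fun z hz =>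
    (hgG _ (h.mem_open z (hSN hz) hz.2)).comp z (h.hasFDerivAt (hSN hz))
  have hl : 0 ≤ l (θ y) := h.nonneg.self_of_nhds hy
  have hyB : ψ (θ y) ∈ B := by rwa [h.apply_eq]
  -- The extension theorem for derivatives rests on the mean value inequality and needs a convex
  -- domain; this is why g is first pulled back to the half-ball.
  have key : HasFDerivWithinAt (g ∘ ψ) ((G (ψ (θ y))).comp (fderiv ℝ ψ (θ y))) (closure S)
      (θ y) := by
    refine hasFDerivWithinAt_closure_of_tendsto_fderiv
      (fun z hz => (hcomp z hz).differentiableAt.differentiableWithinAt)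
      ((convex_ball _ _).inter (convex_halfSpace_gt l.toLinearMap.isLinear 0))
      (Metric.isOpen_ball.inter (isOpen_lt continuous_const l.continuous)) ?_ ?_
    · intro z hz
      have hz' := hclS hz
      exact (hg _ (h.mem_closed z hz'.1 hz'.2)).comp
        (h.hasFDerivAt hz'.1).continuousAt.continuousWithinAt hmaps
    · have h1 : ContinuousWithinAt (G ∘ ψ) S (θ y) :=
        (hG _ hyB).comp (h.hasFDerivAt h.mem).continuousAt.continuousWithinAt hmaps
      have h2 : ContinuousAt (fderiv ℝ ψ) (θ y) :=
        (h.contDiffOn.continuousOn_fderiv_of_isOpen h.isOpen le_rfl).continuousAt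
          (h.isOpen.mem_nhds h.mem)
      have h3 := h1.clm_comp h2.continuousWithinAt
      refine h3.tendsto.congr' ?_
      filter_upwards [self_mem_nhdsWithin] with z hz
      exact (hcomp z hz).fderiv.symm
  -- T is the part of B near y which θ maps into `closure S`. Composing with θ there undoes ψ, and
  -- the two derivatives cancel.
  let T : Set E := B ∩ θ ⁻¹' Metric.ball (θ y) r ∩ {y' | y' ∈ B → 0 ≤ l (θ y')}
  have hT : T ∈ 𝓝[B] y := by
    refine inter_mem (inter_mem self_mem_nhdsWithin ?_) (mem_nhdsWithin_of_mem_nhds h.nonneg)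
    exact mem_nhdsWithin_of_mem_nhds
      (h.differentiableAt.continuousAt.preimage_mem_nhds (Metric.ball_mem_nhds _ hr))
  have hmapsT : MapsTo θ T (closure S) := fun y' hy' =>
    h.mem_closure_inter Metric.isOpen_ball hy'.1.2 (hy'.2 hy'.1.1)
  have h4 := key.comp y h.differentiableAt.hasFDerivAt.hasFDerivWithinAt hmapsT
  rw [ContinuousLinearMap.comp_assoc, h.fderiv_comp, ContinuousLinearMap.comp_id, h.apply_eq] at h4
  have h5 : HasFDerivWithinAt g (G y) T y := by
    refine h4.congr_of_eventuallyEq ?_ ?_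
    · filter_upwards [mem_nhdsWithin_of_mem_nhds h.right_inv] with y' hy'
      simp only [Function.comp, hy']
    · simp only [Function.comp, h.apply_eq]
  exact h5.mono_of_mem_nhdsWithin hT

end IsHalfSpaceParam

end HalfSpace

/-! ### Domains with smooth boundary, seen in a chart. -/

section SmoothBoundary

variable {n : ℕ} {M : Type w} [TopologicalSpace M] [ChartedSpace (EuclideanSpace ℝ (Fin n)) M]
  {Y : Set M} {V : Set (EuclideanSpace ℝ (Fin n))} {p : M}

lemma isOpen_inter_chartAt_symm_preimage (hV : IsOpen V)
    (hVp : V ⊆ (chartAt (EuclideanSpace ℝ (Fin n)) p).target) (hY : IsOpen Y) :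
    IsOpen (V ∩ (chartAt (EuclideanSpace ℝ (Fin n)) p).symm ⁻¹' Y) := by
  have h := hV.inter ((chartAt (EuclideanSpace ℝ (Fin n)) p).isOpen_inter_preimage_symm hY)
  rwa [← inter_assoc, inter_eq_left.2 hVp] at h

variable [IsManifold (𝓡 n) ∞ M]

/-- The chart of `M` at a boundary point, seen from another chart. -/
lemma HasSmoothBoundary.exists_isHalfSpaceParam (hY : HasSmoothBoundary n Y) (hV : IsOpen V)
    (hVp : V ⊆ (chartAt (EuclideanSpace ℝ (Fin n)) p).target) {y : EuclideanSpace ℝ (Fin n)}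
    (hy : y ∈ V) (hyY : (chartAt (EuclideanSpace ℝ (Fin n)) p).symm y ∈ closure Y \ Y) :
    ∃ l ψ θ N, IsHalfSpaceParam
      (V ∩ (chartAt (EuclideanSpace ℝ (Fin n)) p).symm ⁻¹' closure Y)
      (V ∩ (chartAt (EuclideanSpace ℝ (Fin n)) p).symm ⁻¹' Y) y l ψ θ N := by
  set c := chartAt (EuclideanSpace ℝ (Fin n)) p with hc
  obtain ⟨φ, hφ, hyφ, l, hl, hφl⟩ := hY.2 _ hyY
  have hyc : y ∈ c.target := hVp hy
  have hev : ∀ᶠ y' in 𝓝 y, y' ∈ V ∧ c.symm y' ∈ φ.source :=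
    (hV.eventually_mem hy).and
      ((c.continuousAt_symm hyc).eventually_mem (φ.open_source.mem_nhds hyφ))
  -- ψ and θ are the transition maps between the straightening chart φ and c; the domain of ψ is cut
  -- down so that its values lie in V.
  refine ⟨l, c ∘ φ.symm, φ ∘ c.symm, φ.target ∩ φ.symm ⁻¹' (c.source ∩ c ⁻¹' V), hl, ?_, ?_, ?_, ?_,
    ?_, ?_, ?_, ?_⟩
  · exact φ.isOpen_inter_preimage_symm (c.isOpen_inter_preimage hV)
  · refine ⟨φ.map_source hyφ, ?_⟩
    simp only [mem_preimage, Function.comp, φ.left_inv hyφ, mem_inter_iff, c.right_inv hyc]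
    exact ⟨c.map_target hyc, hy⟩
  · have h1 : ContMDiffOn (𝓡 n) (𝓡 n) ∞ (c ∘ φ.symm)
        (φ.target ∩ φ.symm ⁻¹' (c.source ∩ c ⁻¹' V)) :=
      (contMDiffOn_chart (x := p)).comp
        ((contMDiffOn_symm_of_mem_maximalAtlas hφ).mono inter_subset_left) fun z hz => hz.2.1
    exact (contMDiffOn_iff_contDiffOn.1 h1).of_le (by simp)
  · have h1 : ContMDiffAt (𝓡 n) (𝓡 n) ∞ (φ ∘ c.symm) y :=
      ((contMDiffOn_of_mem_maximalAtlas hφ).contMDiffAt (φ.open_source.mem_nhds hyφ)).comp y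
        (RealBundle.contMDiffAt_chartAt_symm hyc)
    exact (contMDiffAt_iff_contDiffAt.1 h1).differentiableAt (by simp)
  · filter_upwards [hev] with y' hy'
    simp only [Function.comp, φ.left_inv hy'.2, c.right_inv (hVp hy'.1)]
  · intro z hz hlz
    refine ⟨hz.2.2, ?_⟩
    have h1 : c.symm ((c ∘ φ.symm) z) = φ.symm z := c.left_inv hz.2.1
    rw [mem_preimage, h1, (hφl _ (φ.map_target hz.1)).1, φ.right_inv hz.1]
    exact hlz
  · intro z hz hlz
    refine ⟨hz.2.2, ?_⟩
    have h1 : c.symm ((c ∘ φ.symm) z) = φ.symm z := c.left_inv hz.2.1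
    rw [mem_preimage, h1, (hφl _ (φ.map_target hz.1)).2, φ.right_inv hz.1]
    exact hlz
  · filter_upwards [hev] with y' hy' hB
    exact (hφl _ hy'.2).1.1 hB.2

/-- Uniqueness of derivatives lets smoothness up to the boundary be treated through successive
derivatives within the closed domain. -/
lemma HasSmoothBoundary.uniqueDiffOn (hY : HasSmoothBoundary n Y) (hV : IsOpen V)
    (hVp : V ⊆ (chartAt (EuclideanSpace ℝ (Fin n)) p).target) :
    UniqueDiffOn ℝ (V ∩ (chartAt (EuclideanSpace ℝ (Fin n)) p).symm ⁻¹' closure Y) := by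
  intro y hy
  by_cases hyY : (chartAt (EuclideanSpace ℝ (Fin n)) p).symm y ∈ Y
  · refine ((isOpen_inter_chartAt_symm_preimage hV hVp hY.1).uniqueDiffWithinAt
      ⟨hy.1, hyY⟩).mono ?_
    exact inter_subset_inter_right _ (preimage_mono subset_closure)
  · obtain ⟨l, ψ, θ, N, h⟩ := hY.exists_isHalfSpaceParam hV hVp hy.1 ⟨hy.2, hyY⟩
    exact h.uniqueDiffWithinAt hy

lemma HasSmoothBoundary.hasFDerivWithinAt (hY : HasSmoothBoundary n Y) (hV : IsOpen V)
    (hVp : V ⊆ (chartAt (EuclideanSpace ℝ (Fin n)) p).target)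
    {G : Type*} [NormedAddCommGroup G] [NormedSpace ℝ G] {g : EuclideanSpace ℝ (Fin n) → G}
    {g' : EuclideanSpace ℝ (Fin n) → EuclideanSpace ℝ (Fin n) →L[ℝ] G}
    (hg : ContinuousOn g (V ∩ (chartAt (EuclideanSpace ℝ (Fin n)) p).symm ⁻¹' closure Y))
    (hg' : ContinuousOn g' (V ∩ (chartAt (EuclideanSpace ℝ (Fin n)) p).symm ⁻¹' closure Y))
    (hgg' : ∀ y ∈ V ∩ (chartAt (EuclideanSpace ℝ (Fin n)) p).symm ⁻¹' Y,
      HasFDerivAt g (g' y) y) {y : EuclideanSpace ℝ (Fin n)}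
    (hy : y ∈ V ∩ (chartAt (EuclideanSpace ℝ (Fin n)) p).symm ⁻¹' closure Y) :
    HasFDerivWithinAt g (g' y)
      (V ∩ (chartAt (EuclideanSpace ℝ (Fin n)) p).symm ⁻¹' closure Y) y := by
  by_cases hyY : (chartAt (EuclideanSpace ℝ (Fin n)) p).symm y ∈ Y
  · exact (hgg' y ⟨hy.1, hyY⟩).hasFDerivWithinAt
  · obtain ⟨l, ψ, θ, N, h⟩ := hY.exists_isHalfSpaceParam hV hVp hy.1 ⟨hy.2, hyY⟩
    exact h.hasFDerivWithinAt hy hg hg' hgg'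

end SmoothBoundary

/-! ### Iterated covariant derivatives in coordinates. -/

namespace RealBundle

variable {n : ℕ} {M : Type w} [TopologicalSpace M] [ChartedSpace (EuclideanSpace ℝ (Fin n)) M]
  [IsManifold (𝓡 n) ∞ M]

lemma repDom_tensorPower (W : RealBundle.{u, v, w} M) (p : M) (k : ℕ) :
    repDom n (tensorPower n W k) p = repDom n W p := by
  induction k with
  | zero => rfl
  | succ k ih => exact (repDom_cotangentTensor (tensorPower n W k) p).trans ih

variable {W : RealBundle.{u, v, w} M}
  {nabla : (Π x : M, TangentSpace (𝓡 n) x →L[ℝ] Trivial M ℝ x) →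
    Π x : M, TangentSpace (𝓡 n) x →L[ℝ] (TangentSpace (𝓡 n) x →L[ℝ] Trivial M ℝ x)}
  {nablaW : (Π x : M, W.V x) → Π x : M, TangentSpace (𝓡 n) x →L[ℝ] W.V x}

lemma exists_hasChristoffel_tensorPower {p : M}
    (h : ∃ Γ, HasChristoffel (cotangentTensor n (line M)) nabla p Γ)
    (hW : ∃ Γ, HasChristoffel W nablaW p Γ) (k : ℕ) :
    ∃ Γ, HasChristoffel (tensorPower n W k) (tensorPowerConnection nabla nablaW k) p Γ := by
  induction k with
  | zero => exact hW
  | succ k ih =>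
    obtain ⟨Γ, hΓ⟩ := h
    obtain ⟨Γ', hΓ'⟩ := ih
    exact ⟨_, hΓ.tensorConnection hΓ'⟩

/-- The iterated covariant derivatives of `τ` in local coordinates. -/
def repCov (nabla : (Π x : M, TangentSpace (𝓡 n) x →L[ℝ] Trivial M ℝ x) →
      Π x : M, TangentSpace (𝓡 n) x →L[ℝ] (TangentSpace (𝓡 n) x →L[ℝ] Trivial M ℝ x))
    (nablaW : (Π x : M, W.V x) → Π x : M, TangentSpace (𝓡 n) x →L[ℝ] W.V x)
    (p : M) (τ : Π x, W.V x) (k : ℕ) :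
    EuclideanSpace ℝ (Fin n) → (tensorPower n W k).F :=
  rep n (tensorPower n W k) p (iteratedCov nabla nablaW τ k)

variable {p : M} {τ : Π x, W.V x}
  {Γ : Π k, EuclideanSpace ℝ (Fin n) →
    (tensorPower n W k).F →L[ℝ] EuclideanSpace ℝ (Fin n) →L[ℝ] (tensorPower n W k).F}

/-- This recursion is used in both directions: it yields Dᵏ⁺¹ from the derivative of Dᵏ, and, solved
for the derivative, it controls dDᵏ by Dᵏ⁺¹ and Dᵏ. -/
lemma repCov_succ {k : ℕ}
    (hΓ : HasChristoffel (tensorPower n W k) (tensorPowerConnection nabla nablaW k) p (Γ k))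
    {y : EuclideanSpace ℝ (Fin n)} (hy : y ∈ repDom n W p)
    (hd : DifferentiableAt ℝ (repCov nabla nablaW p τ k) y) :
    repCov nabla nablaW p τ (k + 1) y =
      (fderiv ℝ (repCov nabla nablaW p τ k) y + Γ k y (repCov nabla nablaW p τ k y) :
        EuclideanSpace ℝ (Fin n) →L[ℝ] (tensorPower n W k).F) :=
  hΓ.2 _ y (by rwa [repDom_tensorPower]) hd

/-- The iterated covariant derivatives of a section that is smooth up to the boundary extend
smoothly to the boundary. -/
lemma exists_contDiffOn_eqOn_repCov
    (hΓ : ∀ k, HasChristoffel (tensorPower n W k) (tensorPowerConnection nabla nablaW k) p (Γ k))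
    {A X : Set (EuclideanSpace ℝ (Fin n))} (hA : A ⊆ repDom n W p) (hAu : UniqueDiffOn ℝ A)
    (hX : IsOpen X) (hXA : X ⊆ A) (hτ : ContDiffOn ℝ ∞ (rep n W p τ) A) (k : ℕ) :
    ∃ g, ContDiffOn ℝ ∞ g A ∧ EqOn g (repCov nabla nablaW p τ k) X := by
  induction k with
  | zero => exact ⟨_, hτ, fun _ _ => rfl⟩
  | succ k ih =>
    obtain ⟨g, hg, hgX⟩ := ih
    have hΓA : ContDiffOn ℝ ∞ (Γ k) A := (hΓ k).1.mono (by rwa [repDom_tensorPower])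
    -- At the boundary the full derivative would involve arbitrary values outside A. The extension
    -- therefore follows the same recursion with the derivative within A, which is the full one on
    -- the open set X.
    have h1 : ContDiffOn ℝ ∞ (fun y => fderivWithin ℝ g A y + Γ k y (g y)) A :=
      (hg.fderivWithin hAu (by simp)).add (hΓA.clm_apply hg)
    refine ⟨fun y => fderivWithin ℝ g A y + Γ k y (g y), h1, fun y hy => ?_⟩
    have hAy : A ∈ 𝓝 y := mem_of_superset (hX.mem_nhds hy) hXA
    have hev : repCov nabla nablaW p τ k =ᶠ[𝓝 y] g := by
      filter_upwards [hX.mem_nhds hy] with z hz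
      exact (hgX hz).symm
    have hd : DifferentiableAt ℝ (repCov nabla nablaW p τ k) y :=
      (((hg y (hXA hy)).contDiffAt hAy).differentiableAt (by simp)).congr_of_eventuallyEq hev
    rw [repCov_succ (hΓ k) (hA (hXA hy)) hd, hev.fderiv_eq, hev.self_of_nhds]
    exact congrArg (fun L : EuclideanSpace ℝ (Fin n) →L[ℝ] (tensorPower n W k).F =>
      L + Γ k y (g y)) (fderivWithin_of_mem_nhds hAy)

lemma contDiffOn_repCov
    (hΓ : ∀ k, HasChristoffel (tensorPower n W k) (tensorPowerConnection nabla nablaW k) p (Γ k))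
    {A : Set (EuclideanSpace ℝ (Fin n))} (hA : A ⊆ repDom n W p) (hAo : IsOpen A)
    (hτ : ContDiffOn ℝ ∞ (rep n W p τ) A) (k : ℕ) :
    ContDiffOn ℝ ∞ (repCov nabla nablaW p τ k) A := by
  obtain ⟨g, hg, hgA⟩ := exists_contDiffOn_eqOn_repCov hΓ hA hAo.uniqueDiffOn hAo subset_rfl hτ k
  exact hg.congr fun y hy => (hgA hy).symm

/-- If all iterated covariant derivatives extend continuously to the boundary, the extensions are
smooth up to the boundary. -/
lemma contDiffOn_of_continuousOn_repCov
    (hΓ : ∀ k, HasChristoffel (tensorPower n W k) (tensorPowerConnection nabla nablaW k) p (Γ k))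
    {Y : Set M} (hY : HasSmoothBoundary n Y)
    (hτ : ContDiffOn ℝ ∞ (rep n W p τ)
      (repDom n W p ∩ (chartAt (EuclideanSpace ℝ (Fin n)) p).symm ⁻¹' Y))
    {g : Π k, EuclideanSpace ℝ (Fin n) → (tensorPower n W k).F}
    (hg : ∀ k, ContinuousOn (g k)
      (repDom n W p ∩ (chartAt (EuclideanSpace ℝ (Fin n)) p).symm ⁻¹' closure Y))
    (hgτ : ∀ k, EqOn (g k) (repCov nabla nablaW p τ k)
      (repDom n W p ∩ (chartAt (EuclideanSpace ℝ (Fin n)) p).symm ⁻¹' Y)) (m : ℕ) (k : ℕ) :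
    ContDiffOn ℝ m (g k)
      (repDom n W p ∩ (chartAt (EuclideanSpace ℝ (Fin n)) p).symm ⁻¹' closure Y) := by
  have hVp : repDom n W p ⊆ (chartAt (EuclideanSpace ℝ (Fin n)) p).target := inter_subset_left
  have hVo : IsOpen (repDom n W p) := isOpen_repDom W p
  have hYo := isOpen_inter_chartAt_symm_preimage hVo hVp hY.1
  -- All k are treated at once: order m + 1 for `g k` comes from order m for `g k` and `g (k + 1)`.
  induction m generalizing k with
  | zero => exact contDiffOn_zero.2 (hg k)
  | succ m ih =>
    have hΓB : ContDiffOn ℝ ∞ (Γ k)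
        (repDom n W p ∩ (chartAt (EuclideanSpace ℝ (Fin n)) p).symm ⁻¹' closure Y) :=
      (hΓ k).1.mono (by rw [repDom_tensorPower]; exact inter_subset_left)
    let G : EuclideanSpace ℝ (Fin n) → EuclideanSpace ℝ (Fin n) →L[ℝ] (tensorPower n W k).F :=
      g (k + 1)
    have hG : ContDiffOn ℝ m G
        (repDom n W p ∩ (chartAt (EuclideanSpace ℝ (Fin n)) p).symm ⁻¹' closure Y) := ih (k + 1)
    have hG' : ContDiffOn ℝ m (fun y => G y - Γ k y (g k y))
        (repDom n W p ∩ (chartAt (EuclideanSpace ℝ (Fin n)) p).symm ⁻¹' closure Y) :=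
      -- The candidate for the derivative of `g k` is the recursion Dᵏ⁺¹ = dDᵏ + Γₖ Dᵏ solved for
      -- dDᵏ; it makes sense up to the boundary.
      hG.sub ((hΓB.of_le (by exact_mod_cast le_top)).clm_apply (ih k))
    have hder : ∀ y ∈ repDom n W p ∩ (chartAt (EuclideanSpace ℝ (Fin n)) p).symm ⁻¹' Y,
        HasFDerivAt (g k) (G y - Γ k y (g k y)) y := by
      intro y hy
      have hd : DifferentiableAt ℝ (repCov nabla nablaW p τ k) y :=
        (((contDiffOn_repCov hΓ inter_subset_left hYo hτ k) y hy).contDiffAt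
          (hYo.mem_nhds hy)).differentiableAt (by simp)
      have h1 : G y = fderiv ℝ (repCov nabla nablaW p τ k) y +
          Γ k y (repCov nabla nablaW p τ k y) :=
        (hgτ (k + 1) hy).trans (repCov_succ (hΓ k) hy.1 hd)
      rw [h1, hgτ k hy, add_sub_cancel_right]
      refine hd.hasFDerivAt.congr_of_eventuallyEq ?_
      filter_upwards [hYo.mem_nhds hy] with z hz
      exact hgτ k hz
    have hB : UniqueDiffOn ℝ
        (repDom n W p ∩ (chartAt (EuclideanSpace ℝ (Fin n)) p).symm ⁻¹' closure Y) :=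
      hY.uniqueDiffOn hVo hVp
    rw [Nat.cast_add, Nat.cast_one, contDiffOn_succ_iff_hasFDerivWithinAt_of_uniqueDiffOn hB]
    refine ⟨by simp, _, hG', fun y hy => ?_⟩
    exact hY.hasFDerivWithinAt hVo hVp (hg k) hG'.continuousOn hder hy

end RealBundle

/-! ### Topology of the total space of a vector bundle. -/

section TotalSpace

variable {B : Type*} [TopologicalSpace B] {F : Type*} [NormedAddCommGroup F]
  {E : B → Type*} [TopologicalSpace (TotalSpace F E)] [∀ x, TopologicalSpace (E x)]
  [FiberBundle F E]

/-- Points over different base points are separated in the base, points of one fibre in a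
trivialization. -/
lemma FiberBundle.t2Space_totalSpace [T2Space B] : T2Space (TotalSpace F E) := by
  refine ⟨fun z z' hzz' => ?_⟩
  by_cases hb : z.proj = z'.proj
  · let e := trivializationAt F E z.proj
    have hz : z ∈ e.source := e.mem_source.2 (FiberBundle.mem_baseSet_trivializationAt' _)
    have hz' : z' ∈ e.source :=
      e.mem_source.2 (hb ▸ FiberBundle.mem_baseSet_trivializationAt' z.proj)
    have hne : e z ≠ e z' := fun h => hzz' (e.injOn hz hz' h)
    obtain ⟨u, u', hu, hu', hzu, hzu', hd⟩ := t2_separation hne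
    refine ⟨e.source ∩ e ⁻¹' u, e.source ∩ e ⁻¹' u', ?_, ?_, ⟨hz, hzu⟩, ⟨hz', hzu'⟩, ?_⟩
    · exact e.continuousOn.isOpen_inter_preimage e.open_source hu
    · exact e.continuousOn.isOpen_inter_preimage e.open_source hu'
    · exact (hd.preimage e).mono inter_subset_right inter_subset_right
  · obtain ⟨u, u', hu, hu', hzu, hzu', hd⟩ := t2_separation hb
    exact ⟨_, _, hu.preimage (FiberBundle.continuous_proj F E),
      hu'.preimage (FiberBundle.continuous_proj F E), hzu, hzu', hd.preimage _⟩

variable [NormedSpace ℝ F]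

lemma FiberBundle.locallyCompactSpace_totalSpace [LocallyCompactSpace B] [FiniteDimensional ℝ F] :
    LocallyCompactSpace (TotalSpace F E) := by
  have : ProperSpace F := FiniteDimensional.proper_real F
  exact ChartedSpace.locallyCompactSpace (B × F) (TotalSpace F E)

lemma FiberBundle.secondCountableTopology_totalSpace [SecondCountableTopology B]
    [FiniteDimensional ℝ F] [∀ x, Zero (E x)] : SecondCountableTopology (TotalSpace F E) := by
  have : ProperSpace F := FiniteDimensional.proper_real F
  obtain ⟨s, hs, hsu⟩ := TopologicalSpace.countable_cover_nhds
    (f := fun x : B => (trivializationAt F E x).baseSet) fun x =>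
      (trivializationAt F E x).open_baseSet.mem_nhds (FiberBundle.mem_baseSet_trivializationAt' x)
  -- The preferred chart at a vector is the trivialization at its base point, so the zero vectors
  -- over s index a countable family of charts covering the total space.
  refine ChartedSpace.secondCountable_of_countable_cover (B × F)
    (s := (fun x : B => (⟨x, 0⟩ : TotalSpace F E)) '' s) ?_ (hs.image _)
  refine eq_univ_of_forall fun z => ?_
  have hz : z.proj ∈ ⋃ x ∈ s, (trivializationAt F E x).baseSet := hsu ▸ mem_univ _
  simp only [mem_iUnion] at hz ⊢
  obtain ⟨x, hx, hzx⟩ := hz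
  exact ⟨⟨x, 0⟩, mem_image_of_mem _ hx, (trivializationAt F E x).mem_source.2 hzx⟩

end TotalSpace

/-! ### The construction of the thin neighbourhood O'. -/

section Approximation

/-- A neighbourhood of `C ∩ O` in `O` that is so thin near `C \ O` that the limits along `C ∩ O` of
countably many maps at the points of `C \ O` are limits along the neighbourhood. -/
lemma exists_isOpen_tendsto {M : Type*} [MetricSpace M] {Z : ℕ → Type*} [∀ k, MetricSpace (Z k)]
    {C O : Set M} (hC : IsClosed C) (hO : IsOpen O) {f : Π k, M → Z k}
    (hf : ∀ k, ContinuousOn (f k) O) :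
    ∃ O' : Set M, IsOpen O' ∧ O' ⊆ O ∧ C ∩ O ⊆ O' ∧
      ∀ (k : ℕ) (a : ℕ → M) (x : M) (L : Z k), (∀ m, a m ∈ O') → x ∈ C \ O →
        Tendsto a atTop (𝓝 x) → Tendsto (f k) (𝓝[C ∩ O] x) (𝓝 L) →
        Tendsto (fun m => f k (a m)) atTop (𝓝 L) := by
  -- The distance to the empty set is 0 by convention, which would make ε vanish; in that case O
  -- itself works.
  rcases (C \ O).eq_empty_or_nonempty with hemp | hne
  · refine ⟨O, hO, subset_rfl, inter_subset_right, fun k a x L _ hx => ?_⟩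
    rw [hemp] at hx
    exact hx.elim
  have hB : IsClosed (C \ O) := hC.sdiff hO
  let ε : M → ℝ := fun p => Metric.infDist p (C \ O) / 2
  have hε : ∀ p ∈ C ∩ O, 0 < ε p := fun p hp =>
    half_pos ((hB.notMem_iff_infDist_pos hne).1 fun h => h.2 hp.2)
  -- Only finitely many maps are controlled at each p, which keeps `U` open, but their number grows
  -- without bound as p approaches `C \ O`, so every fixed k is eventually included.
  have hU : ∀ p ∈ C ∩ O, ∃ U : Set M, IsOpen U ∧ p ∈ U ∧ ∀ u ∈ U, u ∈ O ∧ dist u p < ε p ∧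
      ∀ k < ⌈(ε p)⁻¹⌉₊, dist (f k u) (f k p) < ε p := by
    intro p hp
    have h1 : ∀ᶠ u in 𝓝 p, u ∈ O ∧ dist u p < ε p ∧
        ∀ k < ⌈(ε p)⁻¹⌉₊, dist (f k u) (f k p) < ε p := by
      have h0 : ∀ᶠ u in 𝓝 p, dist u p < ε p := Metric.ball_mem_nhds p (hε p hp)
      refine (hO.eventually_mem hp.2).and (h0.and ?_)
      refine (eventually_all_finite (finite_lt_nat ⌈(ε p)⁻¹⌉₊)).2 fun k _ => ?_
      exact ((hf k p hp.2).continuousAt (hO.mem_nhds hp.2)).eventually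
        (Metric.ball_mem_nhds _ (hε p hp))
    obtain ⟨U, hU, hUo, hpU⟩ := eventually_nhds_iff.1 h1
    exact ⟨U, hUo, hpU, hU⟩
  choose! U hUo hpU hU using hU
  refine ⟨⋃ p ∈ C ∩ O, U p, isOpen_biUnion hUo, iUnion₂_subset fun p hp u hu => (hU p hp u hu).1,
    fun p hp => mem_biUnion hp (hpU p hp), ?_⟩
  intro k a x L ha hx hax hL
  have ha' : ∀ m, ∃ p ∈ C ∩ O, a m ∈ U p := fun m => by simpa using ha m
  choose q hq haq using ha'
  have hεx : ∀ m, ε (q m) ≤ dist (q m) x / 2 := fun m => by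
    have := Metric.infDist_le_dist_of_mem (x := q m) hx
    simp only [ε]
    linarith
  -- The factor 1/2 in ε matters here: dist(q, x) ≤ ε(q) + dist(a, x) ≤ dist(q, x)/2 + dist(a, x),
  -- and the first term can be absorbed.
  have hqx : ∀ m, dist (q m) x ≤ 2 * dist (a m) x := by
    intro m
    have h1 := (hU _ (hq m) _ (haq m)).2.1
    have h2 := dist_triangle_left (q m) x (a m)
    have h3 := hεx m
    linarith
  have hdist : Tendsto (fun m => dist (a m) x) atTop (𝓝 0) := tendsto_iff_dist_tendsto_zero.1 hax
  have hq0 : Tendsto (fun m => dist (q m) x) atTop (𝓝 0) :=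
    squeeze_zero (fun _ => dist_nonneg) hqx (by simpa using hdist.const_mul 2)
  have hqt : Tendsto q atTop (𝓝[C ∩ O] x) :=
    tendsto_nhdsWithin_iff.2 ⟨tendsto_iff_dist_tendsto_zero.2 hq0, Eventually.of_forall hq⟩
  have hε0 : Tendsto (fun m => ε (q m)) atTop (𝓝 0) :=
    squeeze_zero (fun m => (hε _ (hq m)).le) hεx (by simpa using hq0.div_const 2)
  have hk : ∀ᶠ m in atTop, k < ⌈(ε (q m))⁻¹⌉₊ := by
    have hpos : (0 : ℝ) < ((k : ℝ) + 1)⁻¹ := by positivity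
    filter_upwards [hε0.eventually_lt_const hpos] with m hm
    rw [Nat.lt_ceil]
    have h1 := (lt_inv_comm₀ (hε _ (hq m)) (by positivity)).1 hm
    linarith
  refine tendsto_of_tendsto_of_dist (hL.comp hqt) ?_
  refine squeeze_zero' (Eventually.of_forall fun _ => dist_nonneg) ?_ hε0
  filter_upwards [hk] with m hm
  rw [dist_comm]
  exact ((hU _ (hq m) _ (haq m)).2.2 k hm).le

end Approximation

/-! ### Continuity and smoothness of sections, read in coordinates. -/

namespace RealBundle

variable {n : ℕ} {M : Type w} [TopologicalSpace M] [ChartedSpace (EuclideanSpace ℝ (Fin n)) M]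
  (W : RealBundle.{u, v, w} M)

lemma coord_injective {p x : M} (hx : x ∈ (trivializationAt W.F W.V p).baseSet) :
    Function.Injective (W.coord p x) := by
  intro z z' h
  rw [← (trivializationAt W.F W.V p).symmL_continuousLinearMapAt (R := ℝ) hx z,
    ← (trivializationAt W.F W.V p).symmL_continuousLinearMapAt (R := ℝ) hx z']
  exact congrArg _ h

lemma coord_surjective {p x : M} (hx : x ∈ (trivializationAt W.F W.V p).baseSet) :
    Function.Surjective (W.coord p x) := fun a =>
  ⟨(trivializationAt W.F W.V p).symmL ℝ x a,
    (trivializationAt W.F W.V p).continuousLinearMapAt_symmL hx a⟩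

lemma rep_chartAt (D : Π x, W.V x) {p x : M}
    (hx : x ∈ (chartAt (EuclideanSpace ℝ (Fin n)) p).source) :
    rep n W p D (chartAt (EuclideanSpace ℝ (Fin n)) p x) = W.coord p x (D x) := by
  rw [rep, (chartAt (EuclideanSpace ℝ (Fin n)) p).left_inv hx]

/-- Convergence of a section to a point of the total space, in local coordinates. -/
lemma tendsto_totalSpace_iff (D : Π x, W.V x) {p : M} {f : Filter M} (hf : f ≤ 𝓝 p) (z : W.V p) :
    Tendsto (fun x => (⟨x, D x⟩ : TotalSpace W.F W.V)) f (𝓝 ⟨p, z⟩) ↔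
      Tendsto (fun x => rep n W p D (chartAt (EuclideanSpace ℝ (Fin n)) p x)) f
        (𝓝 (W.coord p p z)) := by
  let e := trivializationAt W.F W.V p
  have hp : p ∈ e.baseSet := FiberBundle.mem_baseSet_trivializationAt' p
  rw [e.tendsto_nhds_iff (e.mem_source.2 hp), coord_eq W hp]
  have h1 : Tendsto (TotalSpace.proj ∘ fun x => (⟨x, D x⟩ : TotalSpace W.F W.V)) f (𝓝 p) := hf
  refine ⟨fun h => h.2.congr' ?_, fun h => ⟨h1, h.congr' ?_⟩⟩
  all_goals
    filter_upwards [hf (e.open_baseSet.mem_nhds hp),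
      hf ((chartAt (EuclideanSpace ℝ (Fin n)) p).open_source.mem_nhds (mem_chart_source _ p))]
      with x hx hx'
    rw [rep_chartAt W D hx', coord_eq W hx]

lemma continuousOn_rep {D : Π x, W.V x} {S : Set M}
    (hD : ContinuousOn (fun x => (⟨x, D x⟩ : TotalSpace W.F W.V)) S) (p : M) :
    ContinuousOn (rep n W p D)
      (repDom n W p ∩ (chartAt (EuclideanSpace ℝ (Fin n)) p).symm ⁻¹' S) := by
  let e := trivializationAt W.F W.V p
  have h1 : ContinuousOn (fun y => e ⟨(chartAt (EuclideanSpace ℝ (Fin n)) p).symm y,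
      D ((chartAt (EuclideanSpace ℝ (Fin n)) p).symm y)⟩)
      (repDom n W p ∩ (chartAt (EuclideanSpace ℝ (Fin n)) p).symm ⁻¹' S) :=
    e.continuousOn.comp (hD.comp ((chartAt (EuclideanSpace ℝ (Fin n)) p).continuousOn_symm.mono
      fun y hy => hy.1.1) fun y hy => hy.2) fun y hy => e.mem_source.2 hy.1.2
  refine (continuous_snd.comp_continuousOn h1).congr fun y hy => ?_
  exact coord_eq W hy.1.2 _

variable [IsManifold (𝓡 n) ∞ M] [ContMDiffVectorBundle ∞ W.F W.V (𝓡 n)]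

lemma contDiffOn_rep {D : Π x, W.V x} {S : Set M} (hD : SmoothSectionOn W.F n D S) (p : M) :
    ContDiffOn ℝ ∞ (rep n W p D)
      (repDom n W p ∩ (chartAt (EuclideanSpace ℝ (Fin n)) p).symm ⁻¹' S) := by
  let e := trivializationAt W.F W.V p
  have h1 : ContMDiffOn (𝓡 n) 𝓘(ℝ, W.F) ∞ (fun x => (e ⟨x, D x⟩).2) (S ∩ e.baseSet) := by
    intro x hx
    exact ((e.contMDiffWithinAt_section _ hx.2).1 (hD x hx.1)).mono inter_subset_left
  have h2 := h1.comp ((contMDiffOn_chart_symm (I := 𝓡 n) (n := ∞) (x := p)).mono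
    fun y (hy : y ∈ repDom n W p ∩ (chartAt (EuclideanSpace ℝ (Fin n)) p).symm ⁻¹' S) => hy.1.1)
    fun y hy => ⟨hy.2, hy.1.2⟩
  refine (contMDiffOn_iff_contDiffOn.1 h2).congr fun y hy => ?_
  exact coord_eq W hy.1.2 _

lemma contMDiffWithinAt_of_rep {D : Π x, W.V x} {S : Set M} {p : M} (hp : p ∈ S)
    (hD : ContDiffOn ℝ ∞ (rep n W p D)
      (repDom n W p ∩ (chartAt (EuclideanSpace ℝ (Fin n)) p).symm ⁻¹' S)) :
    ContMDiffWithinAt (𝓡 n) ((𝓡 n).prod 𝓘(ℝ, W.F)) ∞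
      (fun x => (⟨x, D x⟩ : TotalSpace W.F W.V)) S p := by
  let e := trivializationAt W.F W.V p
  set c := chartAt (EuclideanSpace ℝ (Fin n)) p with hc
  have hpe : p ∈ e.baseSet := FiberBundle.mem_baseSet_trivializationAt' p
  have hpc : p ∈ c.source := mem_chart_source _ p
  rw [e.contMDiffWithinAt_section _ hpe]
  have hopen : c.source ∩ e.baseSet ∈ 𝓝 p :=
    inter_mem (c.open_source.mem_nhds hpc) (e.open_baseSet.mem_nhds hpe)
  have h1 : ContMDiffOn (𝓡 n) 𝓘(ℝ, W.F) ∞ (rep n W p D ∘ c) (S ∩ (c.source ∩ e.baseSet)) := by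
    refine (contMDiffOn_iff_contDiffOn.2 hD).comp
      ((contMDiffOn_chart (I := 𝓡 n) (n := ∞) (x := p)).mono fun x hx => hx.2.1) fun x hx => ?_
    refine ⟨W.chartAt_mem_repDom hx.2.1 hx.2.2, ?_⟩
    rw [mem_preimage, c.left_inv hx.2.1]
    exact hx.1
  have h2 : ContMDiffOn (𝓡 n) 𝓘(ℝ, W.F) ∞ (fun x => (e ⟨x, D x⟩).2)
      (S ∩ (c.source ∩ e.baseSet)) := by
    refine h1.congr fun x hx => ?_
    rw [Function.comp, hc, rep_chartAt W D hx.2.1, coord_eq W hx.2.2]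
  exact (h2 p ⟨hp, hpc, hpe⟩).mono_of_mem_nhdsWithin
    (inter_mem self_mem_nhdsWithin (mem_nhdsWithin_of_mem_nhds hopen))

end RealBundle

/-! ### Iterated covariant derivatives on the manifold. -/

section CovDeriv

variable {n : ℕ} {M : Type w} [TopologicalSpace M] [ChartedSpace (EuclideanSpace ℝ (Fin n)) M]
  [IsManifold (𝓡 n) ∞ M]
  {F : Type u} [NormedAddCommGroup F] [NormedSpace ℝ F]
  {E : M → Type v} [TopologicalSpace (TotalSpace F E)]
  [∀ x, AddCommGroup (E x)] [∀ x, Module ℝ (E x)] [∀ x, TopologicalSpace (E x)]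
  [∀ x, IsTopologicalAddGroup (E x)] [∀ x, ContinuousSMul ℝ (E x)]
  [FiberBundle F E] [VectorBundle ℝ F E]

lemma finiteDimensional_tensorPower [FiniteDimensional ℝ F] (k : ℕ) :
    FiniteDimensional ℝ (RealBundle.tensorPower n (RealBundle.mk F E) k).F := by
  induction k with
  | zero => exact ‹FiniteDimensional ℝ F›
  | succ k ih =>
    exact inferInstanceAs (FiniteDimensional ℝ
      (EuclideanSpace ℝ (Fin n) →L[ℝ] (RealBundle.tensorPower n (RealBundle.mk F E) k).F))

/-- Urysohn metrization applies because the total space is Hausdorff, locally compact and second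
countable. The metric serves to compare tensors over different points in `exists_isOpen_tendsto`. -/
lemma metrizableSpace_covTensor [T2Space M] [SecondCountableTopology M] [FiniteDimensional ℝ F]
    (k : ℕ) : TopologicalSpace.MetrizableSpace (CovTensor F E n k) := by
  have := finiteDimensional_tensorPower (n := n) (E := E) (F := F) k
  have : LocallyCompactSpace M := ChartedSpace.locallyCompactSpace (EuclideanSpace ℝ (Fin n)) M
  have : T2Space (CovTensor F E n k) := FiberBundle.t2Space_totalSpace
  have : LocallyCompactSpace (CovTensor F E n k) := FiberBundle.locallyCompactSpace_totalSpace
  have : SecondCountableTopology (CovTensor F E n k) :=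
    FiberBundle.secondCountableTopology_totalSpace
  infer_instance

variable [ContMDiffVectorBundle ∞ F E (𝓡 n)] [T2Space M] [FiniteDimensional ℝ F]
  (nabla : CotangentConnection n M) [nabla.ContMDiffCovariantDerivative ∞]
  (nablaE : CovariantDerivative (𝓡 n) F E) [nablaE.ContMDiffCovariantDerivative ∞]

lemma exists_forall_hasChristoffel (p : M) :
    ∃ Γ : Π k, EuclideanSpace ℝ (Fin n) →
        (RealBundle.tensorPower n (RealBundle.mk F E) k).F →L[ℝ]
          EuclideanSpace ℝ (Fin n) →L[ℝ] (RealBundle.tensorPower n (RealBundle.mk F E) k).F,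
      ∀ k, RealBundle.HasChristoffel (RealBundle.tensorPower n (RealBundle.mk F E) k)
        (RealBundle.tensorPowerConnection (W := RealBundle.mk F E) nabla.toFun nablaE.toFun k) p
        (Γ k) := by
  have h := RealBundle.exists_hasChristoffel_tensorPower (W := RealBundle.mk F E)
    (nabla.exists_hasChristoffel p) (nablaE.exists_hasChristoffel p)
  choose Γ hΓ using h
  exact ⟨Γ, hΓ⟩

lemma continuousOn_covDeriv {O : Set M} (hO : IsOpen O) {σ : Π x : M, E x}
    (hσ : SmoothSectionOn F n σ O) (k : ℕ) : ContinuousOn (covDeriv nabla nablaE k σ) O := by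
  intro p hp
  refine ContinuousAt.continuousWithinAt ?_
  let W : RealBundle M := RealBundle.mk F E
  have : ContMDiffVectorBundle ∞ W.F W.V (𝓡 n) := ‹ContMDiffVectorBundle ∞ F E (𝓡 n)›
  obtain ⟨Γ, hΓ⟩ := exists_forall_hasChristoffel nabla nablaE p
  have hA := isOpen_inter_chartAt_symm_preimage (RealBundle.isOpen_repDom (n := n) W p)
    inter_subset_left hO
  have h1 := RealBundle.contDiffOn_repCov hΓ inter_subset_left hA (W.contDiffOn_rep hσ p) k
  have hpc : p ∈ (chartAt (EuclideanSpace ℝ (Fin n)) p).source := mem_chart_source _ p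
  have hmem : chartAt (EuclideanSpace ℝ (Fin n)) p p ∈ RealBundle.repDom n W p ∩
      (chartAt (EuclideanSpace ℝ (Fin n)) p).symm ⁻¹' O := by
    refine ⟨W.self_mem_repDom p, ?_⟩
    rwa [mem_preimage, (chartAt (EuclideanSpace ℝ (Fin n)) p).left_inv hpc]
  have h2 := (h1.continuousOn.continuousAt (hA.mem_nhds hmem)).comp
    ((chartAt (EuclideanSpace ℝ (Fin n)) p).continuousAt hpc)
  refine ((RealBundle.tensorPower n W k).tendsto_totalSpace_iff (n := n) _ le_rfl _).2 ?_
  rw [← RealBundle.rep_chartAt (n := n) _ _ hpc]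
  exact h2

/-- Existence of these limits makes `extendFrom` continuous on `closure X`; that the limit lies over
p makes the extension a section. -/
lemma exists_tendsto_covDeriv {X : Set M} (hX : HasSmoothBoundary n X) {s : Π x : M, E x}
    (hs : SmoothSectionOn F n s (closure X)) (k : ℕ) {p : M} (hp : p ∈ closure X) :
    ∃ v : (RealBundle.tensorPower n (RealBundle.mk F E) k).V p,
      Tendsto (covDeriv nabla nablaE k s) (𝓝[X] p) (𝓝 ⟨p, v⟩) := by
  let W : RealBundle M := RealBundle.mk F E
  have : ContMDiffVectorBundle ∞ W.F W.V (𝓡 n) := ‹ContMDiffVectorBundle ∞ F E (𝓡 n)›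
  obtain ⟨Γ, hΓ⟩ := exists_forall_hasChristoffel nabla nablaE p
  have hVo := RealBundle.isOpen_repDom (n := n) W p
  obtain ⟨g, hg, hgX⟩ := RealBundle.exists_contDiffOn_eqOn_repCov hΓ inter_subset_left
    (hX.uniqueDiffOn hVo inter_subset_left)
    (isOpen_inter_chartAt_symm_preimage hVo inter_subset_left hX.1)
    (inter_subset_inter_right _ (preimage_mono subset_closure)) (W.contDiffOn_rep hs p) k
  have hpc : p ∈ (chartAt (EuclideanSpace ℝ (Fin n)) p).source := mem_chart_source _ p
  have hpV : chartAt (EuclideanSpace ℝ (Fin n)) p p ∈ RealBundle.repDom n W p :=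
    W.self_mem_repDom p
  have hmem : chartAt (EuclideanSpace ℝ (Fin n)) p p ∈ RealBundle.repDom n W p ∩
      (chartAt (EuclideanSpace ℝ (Fin n)) p).symm ⁻¹' closure X := by
    refine ⟨hpV, ?_⟩
    rwa [mem_preimage, (chartAt (EuclideanSpace ℝ (Fin n)) p).left_inv hpc]
  obtain ⟨v, hv⟩ := (RealBundle.tensorPower n W k).coord_surjective
    (FiberBundle.mem_baseSet_trivializationAt' p) (g (chartAt (EuclideanSpace ℝ (Fin n)) p p))
  refine ⟨v, ((RealBundle.tensorPower n W k).tendsto_totalSpace_iff (n := n) _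
    nhdsWithin_le_nhds _).2 ?_⟩
  rw [hv]
  have hev : ∀ᶠ x in 𝓝[X] p, chartAt (EuclideanSpace ℝ (Fin n)) p x ∈ RealBundle.repDom n W p ∩
      (chartAt (EuclideanSpace ℝ (Fin n)) p).symm ⁻¹' X := by
    filter_upwards [self_mem_nhdsWithin, mem_nhdsWithin_of_mem_nhds
      ((chartAt (EuclideanSpace ℝ (Fin n)) p).open_source.mem_nhds hpc), mem_nhdsWithin_of_mem_nhds
      (((chartAt (EuclideanSpace ℝ (Fin n)) p).continuousAt hpc).preimage_mem_nhds
        (hVo.mem_nhds hpV))] with x hx hxc hxV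
    refine ⟨hxV, ?_⟩
    rwa [mem_preimage, (chartAt (EuclideanSpace ℝ (Fin n)) p).left_inv hxc]
  have h1 : Tendsto (fun x => g (chartAt (EuclideanSpace ℝ (Fin n)) p x)) (𝓝[X] p)
      (𝓝 (g (chartAt (EuclideanSpace ℝ (Fin n)) p p))) := by
    refine (hg.continuousOn _ hmem).tendsto.comp (tendsto_nhdsWithin_iff.2 ⟨?_, ?_⟩)
    · exact ((chartAt (EuclideanSpace ℝ (Fin n)) p).continuousAt hpc).tendsto.mono_left
        nhdsWithin_le_nhds
    · exact hev.mono fun x hx => ⟨hx.1, subset_closure hx.2⟩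
  exact h1.congr' (hev.mono fun x hx => hgX hx)

/-- The iterated covariant derivatives depend on the germ of a smooth section only. -/
lemma covDeriv_eq_of_eqOn {O : Set M} (hO : IsOpen O) {σ s : Π x : M, E x}
    (hσ : SmoothSectionOn F n σ O) (hσs : ∀ x ∈ O, σ x = s x) (k : ℕ) {p : M} (hp : p ∈ O) :
    covDeriv nabla nablaE k σ p = covDeriv nabla nablaE k s p := by
  let W : RealBundle M := RealBundle.mk F E
  have : ContMDiffVectorBundle ∞ W.F W.V (𝓡 n) := ‹ContMDiffVectorBundle ∞ F E (𝓡 n)›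
  obtain ⟨Γ, hΓ⟩ := exists_forall_hasChristoffel nabla nablaE p
  have hA := isOpen_inter_chartAt_symm_preimage (RealBundle.isOpen_repDom (n := n) W p)
    inter_subset_left hO
  have hsm := RealBundle.contDiffOn_repCov hΓ inter_subset_left hA (W.contDiffOn_rep hσ p)
  have hpc : p ∈ (chartAt (EuclideanSpace ℝ (Fin n)) p).source := mem_chart_source _ p
  have hmem : chartAt (EuclideanSpace ℝ (Fin n)) p p ∈ RealBundle.repDom n W p ∩
      (chartAt (EuclideanSpace ℝ (Fin n)) p).symm ⁻¹' O := by
    refine ⟨W.self_mem_repDom p, ?_⟩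
    rwa [mem_preimage, (chartAt (EuclideanSpace ℝ (Fin n)) p).left_inv hpc]
  have key : ∀ k, EqOn (RealBundle.repCov (W := W) nabla.toFun nablaE.toFun p s k)
      (RealBundle.repCov (W := W) nabla.toFun nablaE.toFun p σ k)
      (RealBundle.repDom n W p ∩ (chartAt (EuclideanSpace ℝ (Fin n)) p).symm ⁻¹' O) := by
    intro k
    induction k with
    | zero =>
      intro y hy
      exact congrArg (W.coord p _) (hσs _ hy.2).symm
    | succ k ih =>
      intro y hy
      have hev : RealBundle.repCov (W := W) nabla.toFun nablaE.toFun p s k =ᶠ[𝓝 y]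
          RealBundle.repCov (W := W) nabla.toFun nablaE.toFun p σ k := by
        filter_upwards [hA.mem_nhds hy] with z hz
        exact ih hz
      have hd := (((hsm k) y hy).contDiffAt (hA.mem_nhds hy)).differentiableAt (by simp)
      rw [RealBundle.repCov_succ (hΓ k) hy.1 hd,
        RealBundle.repCov_succ (hΓ k) hy.1 (hd.congr_of_eventuallyEq hev), hev.fderiv_eq,
        hev.self_of_nhds]
  have h1 := key k hmem
  simp only [RealBundle.repCov] at h1
  rw [RealBundle.rep_chartAt _ _ hpc, RealBundle.rep_chartAt _ _ hpc] at h1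
  exact congrArg (TotalSpace.mk p) ((RealBundle.coord_injective _
    (FiberBundle.mem_baseSet_trivializationAt' p)) h1).symm

/-- A smooth section of `E` on the interior of a manifold with boundary all of whose iterated
covariant derivatives extend continuously to the boundary extends smoothly to the boundary. -/
lemma smoothSectionOn_closure {Y : Set M} (hY : HasSmoothBoundary n Y) {σ t : Π x : M, E x}
    (hσ : SmoothSectionOn F n σ Y)
    {D : Π k, Π x : M, (RealBundle.tensorPower n (RealBundle.mk F E) k).V x}
    (hD : ∀ k, ContinuousOn (fun x => (⟨x, D k x⟩ : CovTensor F E n k)) (closure Y))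
    (hDσ : ∀ k, ∀ x ∈ Y, (⟨x, D k x⟩ : CovTensor F E n k) = covDeriv nabla nablaE k σ x)
    (ht : ∀ x ∈ closure Y, t x = D 0 x) : SmoothSectionOn F n t (closure Y) := by
  intro p hp
  let W : RealBundle M := RealBundle.mk F E
  have : ContMDiffVectorBundle ∞ W.F W.V (𝓡 n) := ‹ContMDiffVectorBundle ∞ F E (𝓡 n)›
  obtain ⟨Γ, hΓ⟩ := exists_forall_hasChristoffel nabla nablaE p
  refine W.contMDiffWithinAt_of_rep hp ?_
  have h1 := RealBundle.contDiffOn_of_continuousOn_repCov hΓ hY (W.contDiffOn_rep hσ p)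
    (g := fun k => RealBundle.rep n (RealBundle.tensorPower n W k) p (D k)) (fun k => ?_)
    (fun k y hy => ?_)
  -- Only k = 0 is needed in the end; the higher covariant derivatives were there to drive the
  -- induction on m.
  · refine contDiffOn_infty.2 fun m => (h1 m 0).congr fun y hy => ?_
    exact congrArg (W.coord p _) (ht _ hy.2)
  · have h2 := (RealBundle.tensorPower n W k).continuousOn_rep (n := n) (hD k) p
    rwa [RealBundle.repDom_tensorPower] at h2
  · have h2 := hDσ k _ hy.2
    have h3 : D k ((chartAt (EuclideanSpace ℝ (Fin n)) p).symm y) =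
        RealBundle.iteratedCov (W := W) nabla.toFun nablaE.toFun σ k
          ((chartAt (EuclideanSpace ℝ (Fin n)) p).symm y) := TotalSpace.mk_injective _ h2
    exact congrArg ((RealBundle.tensorPower n W k).coord p _) h3

end CovDeriv

end

/-! ### The theorem: extension, choice of O', gluing. -/

theorem lemma5p5
    {n : ℕ} {M : Type*} [TopologicalSpace M] [T2Space M] [SecondCountableTopology M]
    [ChartedSpace (EuclideanSpace ℝ (Fin n)) M] [IsManifold (𝓡 n) ∞ M]
    {F : Type*} [NormedAddCommGroup F] [NormedSpace ℝ F] [FiniteDimensional ℝ F]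
    {E : M → Type*} [TopologicalSpace (TotalSpace F E)]
    [∀ x, AddCommGroup (E x)] [∀ x, Module ℝ (E x)] [∀ x, TopologicalSpace (E x)]
    [∀ x, IsTopologicalAddGroup (E x)] [∀ x, ContinuousSMul ℝ (E x)]
    [FiberBundle F E] [VectorBundle ℝ F E] [ContMDiffVectorBundle ∞ F E (𝓡 n)]
    (nabla : CotangentConnection n M) [nabla.ContMDiffCovariantDerivative ∞]
    (nablaE : CovariantDerivative (𝓡 n) F E) [nablaE.ContMDiffCovariantDerivative ∞]
    (X : Set M) (hX : HasSmoothBoundary n X)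
    (s : Π x : M, E x) (hs : SmoothSectionOn F n s (closure X))
    (O : Set M) (hO : IsOpen O) (hXO : X ⊆ O)
    (σ : Π x : M, E x) (hσ : SmoothSectionOn F n σ O) (hσs : ∀ x ∈ X, σ x = s x) :
    -- `Dᵏ s` is well defined on `closure X`: it is the continuous extension of `Dᵏ (s|X)`
    (∀ k, ContinuousOn (covDerivClosure nabla nablaE X k s) (closure X) ∧
      ∀ x ∈ X, covDerivClosure nabla nablaE X k s x = covDeriv nabla nablaE k s x) ∧
    ∃ O' : Set M, IsOpen O' ∧ O' ⊆ O ∧ closure X ∩ O' = closure X ∩ O ∧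
      (∀ k, PropertyP nabla nablaE X k s O' σ) ∧
      -- the glued section is smooth on every interpolating manifold with boundary
      ∀ Y : Set M, Interpolates n X O' Y →
        ∃ t : Π x : M, E x, (∀ x ∈ closure X, t x = s x) ∧ (∀ x ∈ O', t x = σ x) ∧
          SmoothSectionOn F n t (closure Y) := by
  classical
  have hmet : ∀ k, TopologicalSpace.MetrizableSpace (CovTensor F E n k) :=
    fun k => metrizableSpace_covTensor k
  have hMlc : LocallyCompactSpace M :=
    ChartedSpace.locallyCompactSpace (EuclideanSpace ℝ (Fin n)) M
  have hXc : X ⊆ closure X := subset_closure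
  have hlim := fun k p (hp : p ∈ closure X) => exists_tendsto_covDeriv nabla nablaE hX hs k hp
  have hcont : ∀ k, ContinuousOn (covDerivClosure nabla nablaE X k s) (closure X) := fun k =>
    continuousOn_extendFrom subset_rfl fun p hp => ⟨_, (hlim k p hp).choose_spec⟩
  have hval : ∀ k, ∀ p ∈ closure X, ∃ v : (RealBundle.tensorPower n (RealBundle.mk F E) k).V p,
      covDerivClosure nabla nablaE X k s p = ⟨p, v⟩ := fun k p hp =>
    ⟨_, extendFrom_eq hp (hlim k p hp).choose_spec⟩
  have hval0 : ∀ p ∈ closure X, covDerivClosure nabla nablaE X 0 s p =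
      (⟨p, s p⟩ : TotalSpace F E) := fun p hp =>
    extendFrom_eq hp ((hs.continuousOn p hp).tendsto.mono_left (nhdsWithin_mono p hXc))
  have hσcont : ∀ k, ContinuousOn (covDeriv nabla nablaE k σ) O :=
    continuousOn_covDeriv nabla nablaE hO hσ
  -- Dᵏ σ is continuous on O and equals Dᵏ s on X, so it has the limit along X that defines the
  -- extension.
  have hagree : ∀ k, ∀ x ∈ closure X ∩ O,
      covDerivClosure nabla nablaE X k s x = covDeriv nabla nablaE k σ x := by
    intro k x hx
    refine extendFrom_eq hx.1 ?_
    refine (((hσcont k x hx.2).continuousAt (hO.mem_nhds hx.2)).tendsto.mono_left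
      nhdsWithin_le_nhds).congr' ?_
    filter_upwards [self_mem_nhdsWithin] with x' hx'
    exact covDeriv_eq_of_eqOn nabla nablaE hX.1 (hσ.mono hXO) hσs k hx'
  refine ⟨fun k => ⟨hcont k, fun x hx => ?_⟩, ?_⟩
  · exact extendFrom_extends
      (continuousOn_covDeriv nabla nablaE hX.1 (hs.mono hXc) k) x hx
  obtain ⟨O', hO', hO'O, hCO, hlimO'⟩ : ∃ O' : Set M, IsOpen O' ∧ O' ⊆ O ∧ closure X ∩ O ⊆ O' ∧
      ∀ (k : ℕ) (a : ℕ → M) (x : M) (L : CovTensor F E n k), (∀ m, a m ∈ O') →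
        x ∈ closure X \ O → Tendsto a atTop (𝓝 x) →
        Tendsto (covDeriv nabla nablaE k σ) (𝓝[closure X ∩ O] x) (𝓝 L) →
        Tendsto (fun m => covDeriv nabla nablaE k σ (a m)) atTop (𝓝 L) := by
    -- The metrics are auxiliary and arbitrary: what is extracted from them is purely topological.
    let _ := TopologicalSpace.metrizableSpaceMetric M
    let _ := fun k => TopologicalSpace.metrizableSpaceMetric (CovTensor F E n k)
    exact exists_isOpen_tendsto isClosed_closure hO hσcont
  have hP : ∀ k, PropertyP nabla nablaE X k s O' σ := by
    intro k a x ha hx hax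
    refine hlimO' k a x _ ha ⟨hx.1, fun h => hx.2 (hCO ⟨hx.1, h⟩)⟩ hax ?_
    refine ((hcont k x hx.1).tendsto.mono_left (nhdsWithin_mono x inter_subset_left)).congr' ?_
    filter_upwards [self_mem_nhdsWithin] with x' hx'
    exact hagree k x' hx'
  refine ⟨O', hO', hO'O, ?_, hP, ?_⟩
  · exact (inter_subset_inter_right _ hO'O).antisymm fun x hx => ⟨hx.1, hCO hx⟩
  rintro Y ⟨hY, -, -, hYO', hYX⟩
  have hσs' : ∀ x ∈ closure X ∩ O, σ x = s x := fun x hx =>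
    TotalSpace.mk_injective (F := F) x ((hagree 0 x hx).symm.trans (hval0 x hx.1))
  choose! v hv using hval
  -- The gluing of Dᵏ σ on O' with the extended Dᵏ s on `closure X`; by `hagree` the two match on
  -- the overlap.
  let D : Π k, Π x : M, (RealBundle.tensorPower n (RealBundle.mk F E) k).V x := fun k x =>
    if x ∈ O' then RealBundle.iteratedCov (W := RealBundle.mk F E) nabla.toFun nablaE.toFun σ k x
    else v k x
  have hDO' : ∀ k, ∀ x ∈ O', (⟨x, D k x⟩ : CovTensor F E n k) = covDeriv nabla nablaE k σ x := by
    intro k x hx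
    simp only [D, if_pos hx]
    rfl
  have hDX : ∀ k, ∀ x ∈ closure X,
      (⟨x, D k x⟩ : CovTensor F E n k) = covDerivClosure nabla nablaE X k s x := by
    intro k x hx
    by_cases hxO' : x ∈ O'
    · rw [hDO' k x hxO', hagree k x ⟨hx, hO'O hxO'⟩]
    · simp only [D, if_neg hxO']
      exact (hv k x hx).symm
  have hDcont : ∀ k, ContinuousOn (fun x => (⟨x, D k x⟩ : CovTensor F E n k))
      (closure X ∪ O') := by
    intro k x hx
    by_cases hxO' : x ∈ O'
    · refine ContinuousAt.continuousWithinAt ?_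
      refine ((hσcont k x (hO'O hxO')).continuousAt
        (hO.mem_nhds (hO'O hxO'))).congr_of_eventuallyEq ?_
      filter_upwards [hO'.mem_nhds hxO'] with x' hx'
      exact hDO' k x' hx'
    have hxX : x ∈ closure X := hx.resolve_right hxO'
    -- At a point of `closure X` outside O', the approach along `closure X` is continuity of the
    -- extension, and the approach along O' is property P.
    rw [ContinuousWithinAt, nhdsWithin_union, tendsto_sup, hDX k x hxX]
    constructor
    · refine (hcont k x hxX).tendsto.congr' ?_
      filter_upwards [self_mem_nhdsWithin] with x' hx'
      exact (hDX k x' hx').symm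
    · refine tendsto_of_seq_tendsto fun a ha => ?_
      obtain ⟨hax, haO'⟩ := tendsto_nhdsWithin_iff.1 ha
      obtain ⟨N, hN⟩ := eventually_atTop.1 haO'
      -- Property P asks for every term to lie in O', so the first N terms are dropped.
      rw [← tendsto_add_atTop_iff_nat N]
      have h1 := hP k (fun m => a (m + N)) x (fun m => hN _ (Nat.le_add_left N m)) ⟨hxX, hxO'⟩
        ((tendsto_add_atTop_iff_nat N).2 hax)
      exact h1.congr fun m => (hDO' k _ (hN _ (Nat.le_add_left N m))).symm
  refine ⟨fun x => if x ∈ O' then σ x else s x, ?_, fun x hx => if_pos hx, ?_⟩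
  · intro x hx
    by_cases hxO' : x ∈ O'
    · exact (if_pos hxO').trans (hσs' x ⟨hx, hO'O hxO'⟩)
    · exact if_neg hxO'
  · refine smoothSectionOn_closure nabla nablaE hY (hσ.mono (hYO'.trans hO'O))
      (fun k => (hDcont k).mono hYX) (fun k x hx => hDO' k x (hYO' hx)) fun x hx => ?_
    by_cases hxO' : x ∈ O'
    · simp only [D, if_pos hxO']
      rfl
    · have hxX : x ∈ closure X := (hYX hx).resolve_right hxO'
      simp only [D, if_neg hxO']
      exact TotalSpace.mk_injective (F := F) x ((hval0 x hxX).symm.trans (hv 0 x hxX))
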